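/- Let $\mathfrak g$ be a simple finite-dimensional complex Lie algebra with Cartan subalgebra $\mathfrak t$, root system $\Phi$, simple roots $\alpha_1,\dots,\alpha_n$ (numbered as in Kac's book: $A_n$ is the chain $\alpha_1,\dots,\alpha_n$; in $D_n$ the chain is $\alpha_1,\dots,\alpha_{n-1}$ and $\alpha_n$ is attached to $\alpha_{n-2}$; in $E_6$ the chain is $\alpha_1,\dots,\alpha_5$ and $\alpha_6$ is attached to $\alpha_3$) and highest root $\theta$. Let $\bar\mu$ be a diagram automorphism of order $r$, extended linearly to the root lattice, in one of the five cases 1. $\mathfrak g=A_{2l}$ ($l\ge1$), $r=2$, $\bar\mu(\alpha_i)=\alpha_{2l-i+1}$; 2. $\mathfrak g=A_{2l-1}$ ($l\ge2$), $r=2$, $\bar\mu(\alpha_i)=\alpha_{2l-i}$; 3. $\mathfrak g=D_{l+1}$ ($l\ge2$), $r=2$, $\bar\mu$ exchanges $\alpha_l,\alpha_{l+1}$ and fixes the other simple roots; 4. $\mathfrak g=E_6$ ($l=4$), $r=2$, $\bar\mu$ exchanges $\alpha_1\leftrightarrow\alpha_5$, $\alpha_2\leftrightarrow\alpha_4$ and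 fixes $\alpha_3,\alpha_6$; 5. $\mathfrak g=D_4$ ($l=2$), $r=3$, $\bar\mu:\alpha_1\mapsto\alpha_4\mapsto\alpha_3\mapsto\alpha_1$, $\alpha_2\mapsto\alpha_2$. Let $x_\alpha\in\mathfrak g_\alpha$ ($\alpha\in\Phi$) be root vectors such that $h_\alpha:=[x_\alpha,x_{-\alpha}]$ satisfies $\alpha(h_\alpha)=2$, and let $\mu\in\operatorname{Aut}(\mathfrak g)$ satisfy, for all $\alpha\in\Phi$, $\mu(x_\alpha)=(-1)^{1+\operatorname{ht}\alpha}x_{\bar\mu(\alpha)}$ in case 1 and $\mu(x_\alpha)=x_{\bar\mu(\alpha)}$ in cases 2–5. Put $\theta^0=\theta$ in case 1, $\theta-\alpha_{2l-1}$ in case 2, $\alpha_1+\dots+\alpha_l$ in case 3, $\theta-\alpha_3-\alpha_4-\alpha_6$ in case 4, $\theta-\alpha_2-\alpha_4$ in case 5, and define $F_0,\dots,F_l\in\mathfrak g$ as follows, with $\varepsilon=e^{2\pi i/3}$: 1. $F_0=x_\theta$; $F_i=x_{-\alpha_i}+x_{-\alpha_{2l-i+1}}$ for $1\le i\le l-1$;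 $F_l=\sqrt2\,(x_{-\alpha_l}+x_{-\alpha_{l+1}})$; 2. $F_0=x_{\theta^0}-x_{\bar\mu(\theta^0)}$; $F_i=x_{-\alpha_i}+x_{-\alpha_{2l-i}}$ for $1\le i\le l-1$; $F_l=x_{-\alpha_l}$; 3. $F_0=x_{\theta^0}-x_{\bar\mu(\theta^0)}$; $F_i=x_{-\alpha_i}$ for $1\le i\le l-1$; $F_l=x_{-\alpha_l}+x_{-\alpha_{l+1}}$; 4. $F_0=x_{\theta^0}-x_{\bar\mu(\theta^0)}$; $F_1=x_{-\alpha_1}+x_{-\alpha_5}$; $F_2=x_{-\alpha_2}+x_{-\alpha_4}$; $F_3=x_{-\alpha_3}$; $F_4=x_{-\alpha_6}$; 5. $F_0=x_{\theta^0}+\varepsilon x_{\bar\mu(\theta^0)}+\varepsilon^2x_{\bar\mu^2(\theta^0)}$; $F_1=x_{-\alpha_1}+x_{-\alpha_3}+x_{-\alpha_4}$; $F_2=x_{-\alpha_2}$. Let $\langle\cdot,\cdot\rangle$ be the nondegenerate symmetric invariant bilinear form on $\mathfrak g$ with $\langle\alpha,\alpha\rangle=2$ for all $\alpha\in\Phi$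 (these $\mathfrak g$ are simply laced), and let $\tilde{\mathfrak g}=\mathfrak g\otimes\mathbb C[t,t^{-1}]\oplus\mathbb Cc\oplus\mathbb Cd$ be the untwisted affine Lie algebra, where $c$ is central and, with $x(m)=x\otimes t^m$, $$[x(m),y(n)]=[x,y](m+n)+m\,\delta_{m+n,0}\langle x,y\rangle c,\qquad [d,x(m)]=m\,x(m).$$ Let $k$ be a positive integer, let $N(k\Lambda_0)$ be the $\tilde{\mathfrak g}$-module induced from the one-dimensional module of $\bigoplus_{n\ge0}\mathfrak g(n)\oplus\mathbb Cc\oplus\mathbb Cd$ on which $\mathfrak g(n)$ ($n\ge0$) and $d$ act by $0$ and $c$ acts by $k$, let $\mathbf 1=1\otimes1\in N(k\Lambda_0)$, and let $N^1(k\Lambda_0)$ be the maximal proper $\tilde{\mathfrak g}$-submodule of $N(k\Lambda_0)$. Then there is $n_0$ such that $F_i(-1)^n\mathbf 1\in N^1(k\Lambda_0)$ for all $n\ge n_0$ and all $i\in\{0,1,\dots,l\}$. Explicitly, for every $i\in\{0,\dots,l\}$ one has $F_i(-1)^{tk+1}\mathbf 1\in N^1(k\Lambda_0)$ for some $t\in\{1,2,3\}$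 in cases 2–5, while in case 1 this holds with $t=1$ for $i=0$, $t=2$ for $1\le i\le l-1$, and $t=4$ for $i=l$. -/

import Mathlib

noncomputable section

open scoped TensorProduct

namespace TwistedAffine

/-! ## The untwisted affine Lie algebra attached to an invariant symmetric form -/

section Affine

variable {𝔤 : Type*} [LieRing 𝔤] [LieAlgebra ℂ 𝔤]

/-- The element `x ⊗ tⁿ` of the loop algebra `𝔤 ⊗ ℂ[t, t⁻¹]`. -/
def loopMonomial (x : 𝔤) (n : ℤ) : LieAlgebra.loopAlgebra ℂ ℤ 𝔤 :=
  AddMonoidAlgebra.single n (1 : ℂ) ⊗ₜ[ℂ] x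

theorem neg_lieInvariant (B : LinearMap.BilinForm ℂ 𝔤) (hB : B.lieInvariant 𝔤) :
    (-B).lieInvariant 𝔤 := fun x y z => by
  have := hB x y z
  simp [this]

theorem neg_isSymm (B : LinearMap.BilinForm ℂ 𝔤) (hs : B.IsSymm) : (-B).IsSymm :=
  ⟨fun x y => by simp [hs.eq x y]⟩

variable (B : LinearMap.BilinForm ℂ 𝔤) (hB : B.lieInvariant 𝔤) (hs : B.IsSymm)

/-- The 2-cocycle `(x ⊗ tᵐ, y ⊗ tⁿ) ↦ m δ_{m+n,0} ⟨x, y⟩` of the loop algebra. Mathlib's cocycle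
for a form `Φ` is `n δ_{m+n,0} Φ(x, y)`, so it is used with `Φ = -⟨·,·⟩`. -/
def affineCocycle : LieModule.Cohomology.twoCocycle ℂ (LieAlgebra.loopAlgebra ℂ ℤ 𝔤)
    (TrivialLieModule ℂ (LieAlgebra.loopAlgebra ℂ ℤ 𝔤) ℂ) :=
  LieAlgebra.LoopAlgebra.twoCocycleOfBilinear ℂ ℤ 𝔤 (-B) (neg_lieInvariant B hB) (neg_isSymm B hs)

/-- The central extension `ĝ = 𝔤 ⊗ ℂ[t, t⁻¹] ⊕ ℂc`. -/
abbrev AffineHat : Type _ := LieAlgebra.ofTwoCocycle (affineCocycle B hB hs)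

/-- The linear endomorphism `tⁿ ↦ n tⁿ` of `ℂ[t, t⁻¹]`. -/
def eulerOp : AddMonoidAlgebra ℂ ℤ →ₗ[ℂ] AddMonoidAlgebra ℂ ℤ :=
  (AddMonoidAlgebra.basis ℤ ℂ).constr ℂ fun n => (n : ℂ) • AddMonoidAlgebra.single n (1 : ℂ)

theorem eulerOp_single (n : ℤ) :
    eulerOp (AddMonoidAlgebra.single n (1 : ℂ)) = (n : ℂ) • AddMonoidAlgebra.single n (1 : ℂ) := by
  have := (AddMonoidAlgebra.basis ℤ ℂ).constr_basis ℂ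
    (fun n => (n : ℂ) • AddMonoidAlgebra.single n (1 : ℂ)) n
  simpa [eulerOp] using this

/-- The derivation `x ⊗ tⁿ ↦ n x ⊗ tⁿ` of the loop algebra, as a linear map. -/
def loopEuler : LieAlgebra.loopAlgebra ℂ ℤ 𝔤 →ₗ[ℂ] LieAlgebra.loopAlgebra ℂ ℤ 𝔤 :=
  LinearMap.rTensor 𝔤 eulerOp

theorem loopEuler_monomial (x : 𝔤) (n : ℤ) :
    loopEuler (loopMonomial x n) = (n : ℂ) • loopMonomial x n := by
  simp only [loopEuler, loopMonomial, LinearMap.rTensor_tmul, eulerOp_single,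
    TensorProduct.smul_tmul']

theorem loop_induction {p : LieAlgebra.loopAlgebra ℂ ℤ 𝔤 → Prop}
    (f : LieAlgebra.loopAlgebra ℂ ℤ 𝔤) (h0 : p 0) (hadd : ∀ a b, p a → p b → p (a + b))
    (hm : ∀ x n, p (loopMonomial x n)) : p f := by
  obtain ⟨f, rfl⟩ := (LieAlgebra.LoopAlgebra.toFinsupp ℂ ℤ 𝔤).symm.surjective f
  induction f using Finsupp.induction_linear with
  | zero => simpa using h0
  | add a b ha hb => rw [map_add]; exact hadd _ _ ha hb
  | single n x => simpa [loopMonomial] using hm x n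

theorem lie_loopMonomial (x y : 𝔤) (m n : ℤ) :
    ⁅loopMonomial x m, loopMonomial y n⁆ = loopMonomial ⁅x, y⁆ (m + n) := by
  unfold loopMonomial
  rw [LieAlgebra.ExtendScalars.bracket_tmul, AddMonoidAlgebra.single_mul_single, one_mul]

theorem affineCocycle_monomial (x y : 𝔤) (m n : ℤ) :
    (affineCocycle B hB hs).1 (loopMonomial x m) (loopMonomial y n) =
      (TrivialLieModule.equiv ℂ (LieAlgebra.loopAlgebra ℂ ℤ 𝔤) ℂ).symm
        (if m + n = 0 then (m : ℂ) * B x y else 0) := by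
  refine congrArg (TrivialLieModule.equiv ℂ (LieAlgebra.loopAlgebra ℂ ℤ 𝔤) ℂ).symm ?_
  simp only [loopMonomial, LieAlgebra.LoopAlgebra.residuePairing_apply_apply,
    LieAlgebra.LoopAlgebra.toFinsupp_single_tmul]
  rw [Finsupp.sum_single_index (by simp)]
  split_ifs with h
  · have : m = -n := by lia
    subst this
    simp
  · rw [Finsupp.single_eq_of_ne (by lia)]
    simp

theorem loopEuler_lie (f g : LieAlgebra.loopAlgebra ℂ ℤ 𝔤) :
    loopEuler ⁅f, g⁆ = ⁅loopEuler f, g⁆ + ⁅f, loopEuler g⁆ := by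
  induction f using loop_induction with
  | h0 => rw [zero_lie g, map_zero, zero_lie g, zero_lie (loopEuler g), zero_add]
  | hadd a b ha hb =>
    rw [add_lie a b g, map_add, map_add, ha, hb, add_lie (loopEuler a) (loopEuler b) g,
      add_lie a b (loopEuler g)]
    abel
  | hm x m =>
    induction g using loop_induction with
    | h0 => rw [lie_zero (loopMonomial x m), map_zero, lie_zero (loopMonomial x m),
        lie_zero (loopEuler (loopMonomial x m)), zero_add]
    | hadd a b ha hb =>
      rw [lie_add (loopMonomial x m) a b, map_add, map_add, ha, hb,
        lie_add (loopMonomial x m) (loopEuler a) (loopEuler b),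
        lie_add (loopEuler (loopMonomial x m)) a b]
      abel
    | hm y n =>
      rw [lie_loopMonomial, loopEuler_monomial, loopEuler_monomial, loopEuler_monomial,
        lie_smul (n : ℂ) (loopMonomial x m) (loopMonomial y n),
        smul_lie (m : ℂ) (loopMonomial x m) (loopMonomial y n), lie_loopMonomial, ← add_smul]
      push_cast
      rfl

theorem affineCocycle_loopEuler (f g : LieAlgebra.loopAlgebra ℂ ℤ 𝔤) :
    (affineCocycle B hB hs).1 (loopEuler f) g + (affineCocycle B hB hs).1 f (loopEuler g) = 0 := by
  set c : LieAlgebra.loopAlgebra ℂ ℤ 𝔤 →ₗ[ℂ] LieAlgebra.loopAlgebra ℂ ℤ 𝔤 →ₗ[ℂ]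
    TrivialLieModule ℂ (LieAlgebra.loopAlgebra ℂ ℤ 𝔤) ℂ := (affineCocycle B hB hs).1.1 with hc
  change c (loopEuler f) g + c f (loopEuler g) = 0
  induction f using loop_induction with
  | h0 => simp
  | hadd a b ha hb =>
    have : c (loopEuler (a + b)) g + c (a + b) (loopEuler g) =
      (c (loopEuler a) g + c a (loopEuler g)) + (c (loopEuler b) g + c b (loopEuler g)) := by
      simp only [map_add, LinearMap.add_apply]; abel
    rw [this, ha, hb, add_zero]
  | hm x m =>
    induction g using loop_induction with
    | h0 => simp
    | hadd a b ha hb =>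
      have : c (loopEuler (loopMonomial x m)) (a + b) + c (loopMonomial x m) (loopEuler (a + b)) =
        (c (loopEuler (loopMonomial x m)) a + c (loopMonomial x m) (loopEuler a)) +
        (c (loopEuler (loopMonomial x m)) b + c (loopMonomial x m) (loopEuler b)) := by
        simp only [map_add]; abel
      rw [this, ha, hb, add_zero]
    | hm y n =>
      have h : c (loopMonomial x m) (loopMonomial y n) = _ :=
        affineCocycle_monomial B hB hs x y m n
      rw [loopEuler_monomial, loopEuler_monomial, map_smul, map_smul, LinearMap.smul_apply, h,
        ← add_smul]
      split_ifs with h0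
      · rw [← Int.cast_add, h0, Int.cast_zero, zero_smul]
      · rw [map_zero, smul_zero]

/-- The derivation `d` of `ĝ`: `x ⊗ tⁿ ↦ n x ⊗ tⁿ` and `c ↦ 0`. -/
def degreeDerivation : LieDerivation ℂ (AffineHat B hB hs) (AffineHat B hB hs) where
  toFun f := LieAlgebra.ofProd _ (loopEuler ((LieAlgebra.ofProd _).symm f).1, 0)
  map_add' x y := by simp [← LieAlgebra.of_add]
  map_smul' r x := by simp [← LieAlgebra.of_smul]
  leibniz' a b := by
    obtain ⟨⟨f, u⟩⟩ := a
    obtain ⟨⟨g, v⟩⟩ := b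
    refine congrArg (LieAlgebra.ofProd (affineCocycle B hB hs)) (Prod.ext ?_ ?_)
    · change loopEuler ⁅f, g⁆ = ⁅f, loopEuler g⁆ + -⁅g, loopEuler f⁆
      rw [loopEuler_lie, lie_skew (loopEuler f) g, add_comm]
    · change (0 : TrivialLieModule ℂ (LieAlgebra.loopAlgebra ℂ ℤ 𝔤) ℂ) =
        ((affineCocycle B hB hs).1 f (loopEuler g) + ⁅f, 0⁆ - ⁅loopEuler g, u⁆) +
          -((affineCocycle B hB hs).1 g (loopEuler f) + ⁅g, 0⁆ - ⁅loopEuler f, v⁆)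
      have h := affineCocycle_loopEuler B hB hs f g
      rw [← LieModule.Cohomology.twoCochain_skew (affineCocycle B hB hs).1 (loopEuler f) g]
      simp only [LieModule.IsTrivial.trivial, add_zero, sub_zero, neg_neg]
      rw [add_comm]; exact h.symm

attribute [local instance 100] LieRing.ofAssociativeRing

/-- The action of the abelian Lie algebra `ℂd` on `ĝ`. -/
def degreeAction : ℂ →ₗ⁅ℂ⁆ LieDerivation ℂ (AffineHat B hB hs) (AffineHat B hB hs) where
  __ := LinearMap.toSpanSingleton ℂ _ (degreeDerivation B hB hs)
  map_lie' {x y} := by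
    have : ⁅x, y⁆ = 0 := by rw [LieRing.of_associative_ring_bracket, mul_comm, sub_self]
    simp [this]

/-- The untwisted affine Lie algebra `g̃ = ĝ ⋊ ℂd`. -/
abbrev AffineTilde : Type _ := LieAlgebra.SemiDirectSum (AffineHat B hB hs) ℂ (degreeAction B hB hs)

/-- The element `x(n) = x ⊗ tⁿ` of `g̃`. -/
def monomial (x : 𝔤) (n : ℤ) : AffineTilde B hB hs :=
  ⟨LieAlgebra.ofProd _ (loopMonomial x n, 0), 0⟩

/-- The central element `c` of `g̃`. -/
def central : AffineTilde B hB hs :=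
  ⟨LieAlgebra.ofProd _ (0, (TrivialLieModule.equiv ℂ _ ℂ).symm 1), 0⟩

/-- The element `d` of `g̃`. -/
def degree : AffineTilde B hB hs := ⟨0, 1⟩

theorem lie_monomial (x y : 𝔤) (m n : ℤ) :
    ⁅monomial B hB hs x m, monomial B hB hs y n⁆ =
      monomial B hB hs ⁅x, y⁆ (m + n) +
        (if m + n = 0 then (m : ℂ) * B x y else 0) • central B hB hs := by
  set r : ℂ := if m + n = 0 then (m : ℂ) * B x y else 0 with hr
  refine LieAlgebra.SemiDirectSum.ext ?_ ?_
  · change ⁅(monomial B hB hs x m).left, (monomial B hB hs y n).left⁆ +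
      degreeAction B hB hs 0 _ - degreeAction B hB hs 0 _ = _
    rw [map_zero, LieDerivation.zero_apply, LieDerivation.zero_apply, add_zero, sub_zero]
    refine congrArg (LieAlgebra.ofProd (affineCocycle B hB hs)) (Prod.ext ?_ ?_)
    · change ⁅loopMonomial x m, loopMonomial y n⁆ = loopMonomial ⁅x, y⁆ (m + n) +
        r • (0 : LieAlgebra.loopAlgebra ℂ ℤ 𝔤)
      rw [lie_loopMonomial, smul_zero, add_zero]
    · change (affineCocycle B hB hs).1 (loopMonomial x m) (loopMonomial y n) +
        ⁅loopMonomial x m, (0 : TrivialLieModule ℂ (LieAlgebra.loopAlgebra ℂ ℤ 𝔤) ℂ)⁆ -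
        ⁅loopMonomial y n, (0 : TrivialLieModule ℂ (LieAlgebra.loopAlgebra ℂ ℤ 𝔤) ℂ)⁆ =
        0 + r • (TrivialLieModule.equiv ℂ (LieAlgebra.loopAlgebra ℂ ℤ 𝔤) ℂ).symm 1
      rw [affineCocycle_monomial, ← map_smul, ← hr]
      simp
  · change ⁅(0 : ℂ), (0 : ℂ)⁆ = 0 + r • (0 : ℂ)
    simp

theorem degree_lie_monomial (x : 𝔤) (n : ℤ) :
    ⁅degree B hB hs, monomial B hB hs x n⁆ = (n : ℂ) • monomial B hB hs x n := by
  refine LieAlgebra.SemiDirectSum.ext ?_ ?_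
  · change ⁅(0 : AffineHat B hB hs), (monomial B hB hs x n).left⁆ +
      degreeAction B hB hs 1 _ - degreeAction B hB hs 0 _ = _
    rw [map_zero, LieDerivation.zero_apply, sub_zero, zero_lie, zero_add]
    change (1 : ℂ) • degreeDerivation B hB hs (monomial B hB hs x n).left = _
    rw [one_smul]
    refine congrArg (LieAlgebra.ofProd (affineCocycle B hB hs)) (Prod.ext ?_ ?_)
    · exact loopEuler_monomial x n
    · exact (smul_zero (n : ℂ)).symm
  · change ⁅(1 : ℂ), (0 : ℂ)⁆ = (n : ℂ) • (0 : ℂ)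
    simp

theorem central_lie (y : AffineTilde B hB hs) : ⁅central B hB hs, y⁆ = 0 := by
  obtain ⟨⟨⟨f, u⟩⟩, z⟩ := y
  refine LieAlgebra.SemiDirectSum.ext ?_ ?_
  · change ⁅(central B hB hs).left, (LieAlgebra.ofProd (affineCocycle B hB hs)) (f, u)⁆ +
      degreeAction B hB hs 0 _ - z • degreeDerivation B hB hs (central B hB hs).left = _
    rw [map_zero, LieDerivation.zero_apply, add_zero]
    refine congrArg (LieAlgebra.ofProd (affineCocycle B hB hs)) (Prod.ext ?_ ?_)
    · change ⁅(0 : LieAlgebra.loopAlgebra ℂ ℤ 𝔤), f⁆ + -(z • loopEuler 0) = 0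
      rw [zero_lie f, map_zero, smul_zero, neg_zero, add_zero]
    · change (affineCocycle B hB hs).1.1 0 f + ⁅(0 : LieAlgebra.loopAlgebra ℂ ℤ 𝔤), u⁆ -
        ⁅f, _⁆ + -(z • 0) = 0
      simp only [map_zero, LinearMap.zero_apply, LieModule.IsTrivial.trivial, smul_zero, neg_zero,
        add_zero, sub_zero]
  · change ⁅(0 : ℂ), z⁆ = 0
    simp

/-! ## The vacuum module of level `k` and its maximal submodule -/

/-- The universal enveloping algebra `U(g̃)`. -/
abbrev Env : Type _ := UniversalEnvelopingAlgebra ℂ (AffineTilde B hB hs)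

/-- The left ideal of `U(g̃)` generated by `x(n)` (`x ∈ 𝔤`, `n ≥ 0`), `d` and `c - k`. -/
def vacuumIdeal (k : ℂ) : Submodule (Env B hB hs) (Env B hB hs) :=
  Submodule.span (Env B hB hs)
    ({a | ∃ (x : 𝔤) (n : ℤ), 0 ≤ n ∧ a = UniversalEnvelopingAlgebra.ι ℂ (monomial B hB hs x n)} ∪
      {UniversalEnvelopingAlgebra.ι ℂ (degree B hB hs),
        UniversalEnvelopingAlgebra.ι ℂ (central B hB hs) - algebraMap ℂ (Env B hB hs) k})

/-- The vacuum module `N(kΛ₀) = U(g̃) ⊗_{U(g̃_{≥0})} ℂ`, where `g̃_{≥0}` acts on `ℂ` through the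
character `c ↦ k`, `d ↦ 0`, `x(n) ↦ 0` for `n ≥ 0`. This induced module is the quotient of `U(g̃)`
by the left ideal generated by the kernel of the character. -/
abbrev VacuumModule (k : ℂ) : Type _ := Env B hB hs ⧸ vacuumIdeal B hB hs k

/-- The vacuum vector `𝟏 = 1 ⊗ 1`. -/
def vacuum (k : ℂ) : VacuumModule B hB hs k := (vacuumIdeal B hB hs k).mkQ 1

/-- The maximal proper `g̃`-submodule `N¹(kΛ₀)` of `N(kΛ₀)`: the sum of all proper submodules. -/
def maximalSubmodule (k : ℂ) : Submodule (Env B hB hs) (VacuumModule B hB hs k) :=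
  sSup {W | W ≠ ⊤}

/-- The vector `x(-1)ⁿ 𝟏` of `N(kΛ₀)`. -/
def powVacuum (k : ℂ) (x : 𝔤) (n : ℕ) : VacuumModule B hB hs k :=
  (UniversalEnvelopingAlgebra.ι ℂ (monomial B hB hs x (-1))) ^ n • vacuum B hB hs k

end Affine

/-! ## The five twisted cases -/

/-- The types of pairs (simple Lie algebra, nontrivial diagram automorphism):
`A_{2l}`, `A_{2l-1}`, `D_{l+1}`, `E₆` with an automorphism of order 2, and `D₄` with an
automorphism of order 3. -/
inductive TwistedType : Type
  | Aeven (l : ℕ) (hl : 1 ≤ l)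
  | Aodd (l : ℕ) (hl : 2 ≤ l)
  | D (l : ℕ) (hl : 2 ≤ l)
  | E6
  | D4

namespace TwistedType

/-- The rank of `𝔤`. -/
def rank : TwistedType → ℕ
  | Aeven l _ => 2 * l
  | Aodd l _ => 2 * l - 1
  | D l _ => l + 1
  | E6 => 6
  | D4 => 4

/-- The rank `l` of the fixed point algebra of the diagram automorphism. -/
def l : TwistedType → ℕ
  | Aeven l _ => l
  | Aodd l _ => l
  | D l _ => l
  | E6 => 4
  | D4 => 2

/-- The Cartan matrix of `𝔤`. For `E₆` the simple roots `α₁, …, α₅` form a chain and `α₆` is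
attached to `α₃`; for `D_n` the chain is `α₁, …, α_{n-1}` and `α_n` is attached to `α_{n-2}`. -/
def cartan : (X : TwistedType) → Matrix (Fin X.rank) (Fin X.rank) ℤ
  | Aeven l _ => CartanMatrix.A (2 * l)
  | Aodd l _ => CartanMatrix.A (2 * l - 1)
  | D l _ => CartanMatrix.D (l + 1)
  | E6 =>
    !![ 2, -1,  0,  0,  0,  0;
       -1,  2, -1,  0,  0,  0;
        0, -1,  2, -1,  0, -1;
        0,  0, -1,  2, -1,  0;
        0,  0,  0, -1,  2,  0;
        0,  0, -1,  0,  0,  2]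
  | D4 => CartanMatrix.D 4

/-- The diagram automorphism, as a permutation of the simple roots (numbered from `0` here):
`α_i ↦ α_{n+1-i}` for `A_n`, the exchange of the last two simple roots for `D_{l+1}`,
`α₁ ↔ α₅`, `α₂ ↔ α₄` for `E₆`, and `α₁ ↦ α₄ ↦ α₃ ↦ α₁` for `D₄` in order 3. -/
def diagramPerm : (X : TwistedType) → Equiv.Perm (Fin X.rank)
  | Aeven _ _ => Fin.revPerm
  | Aodd _ _ => Fin.revPerm
  | D l _ => Equiv.swap (⟨l - 1, by lia⟩ : Fin (l + 1)) (Fin.last l)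
  | E6 => Equiv.swap (0 : Fin 6) 4 * Equiv.swap (1 : Fin 6) 3
  | D4 => Equiv.swap (0 : Fin 4) 3 * Equiv.swap (3 : Fin 4) 2

/-- The root lattice, in coordinates with respect to the simple roots `α₁, …, α_n`. -/
abbrev Lattice (X : TwistedType) : Type := Fin X.rank → ℤ

/-- The simple root `α_j`, `1 ≤ j ≤ n`. -/
def simple (X : TwistedType) (j : ℕ) : X.Lattice := fun p => if (p : ℕ) + 1 = j then 1 else 0

/-- The height of an element of the root lattice. -/
def height {X : TwistedType} (γ : X.Lattice) : ℤ := ∑ p, γ p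

/-- The linear extension `μ̄` of the diagram automorphism to the root lattice. -/
def muBar {X : TwistedType} (γ : X.Lattice) : X.Lattice := fun p => γ (X.diagramPerm.symm p)

/-- The highest root `θ`: `α₁ + ⋯ + α_n` for `A_n`, `α₁ + 2(α₂ + ⋯ + α_{l-1}) + α_l + α_{l+1}` for
`D_{l+1}`, `α₁ + 2α₂ + 3α₃ + 2α₄ + α₅ + 2α₆` for `E₆`, `α₁ + 2α₂ + α₃ + α₄` for `D₄`. -/
def highestRoot : (X : TwistedType) → X.Lattice
  | Aeven _ _ => fun _ => 1
  | Aodd _ _ => fun _ => 1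
  | D l _ => fun p : Fin (l + 1) => if 1 ≤ (p : ℕ) ∧ (p : ℕ) + 2 ≤ l then 2 else 1
  | E6 => ![1, 2, 3, 2, 1, 2]
  | D4 => ![1, 2, 1, 1]

/-- The root `θ⁰`: `θ` for `A_{2l}`; `θ - α_{2l-1}` for `A_{2l-1}`;
`(θ + α₁ + α_l - α_{l+1})/2 = α₁ + ⋯ + α_l` for `D_{l+1}`; `θ - α₃ - α₄ - α₆` for `E₆`;
`θ - α₂ - α₄` for `D₄`. -/
def thetaZero : (X : TwistedType) → X.Lattice
  | Aeven l hl => (Aeven l hl).highestRoot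
  | Aodd l hl => (Aodd l hl).highestRoot - (Aodd l hl).simple (2 * l - 1)
  | D l _ => fun p : Fin (l + 1) => if (p : ℕ) < l then 1 else 0
  | E6 => E6.highestRoot - E6.simple 3 - E6.simple 4 - E6.simple 6
  | D4 => D4.highestRoot - D4.simple 2 - D4.simple 4

/-- The sign with which the diagram automorphism acts on root vectors: `μ x_γ = ± x_{μ̄ γ}`. -/
def sign : (X : TwistedType) → X.Lattice → ℂ
  | Aeven _ _, γ => (-1) ^ (1 + height γ)
  | _, _ => 1

/-- The generators `F_0, F_1, …, F_l`, for a family `x` of root vectors. -/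
def F {𝔤 : Type*} [LieRing 𝔤] [LieAlgebra ℂ 𝔤] :
    (X : TwistedType) → (X.Lattice → 𝔤) → ℕ → 𝔤
  | Aeven l hl, x, i =>
    let X := Aeven l hl
    if i = 0 then x X.thetaZero
    else if i < l then x (-X.simple i) + x (-X.simple (2 * l - i + 1))
    else ((Real.sqrt 2 : ℝ) : ℂ) • (x (-X.simple l) + x (-X.simple (l + 1)))
  | Aodd l hl, x, i =>
    let X := Aodd l hl
    if i = 0 then x X.thetaZero - x (muBar X.thetaZero)
    else if i < l then x (-X.simple i) + x (-X.simple (2 * l - i))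
    else x (-X.simple l)
  | D l hl, x, i =>
    let X := D l hl
    if i = 0 then x X.thetaZero - x (muBar X.thetaZero)
    else if i < l then x (-X.simple i)
    else x (-X.simple l) + x (-X.simple (l + 1))
  | E6, x, i =>
    match i with
    | 0 => x E6.thetaZero - x (muBar E6.thetaZero)
    | 1 => x (-E6.simple 1) + x (-E6.simple 5)
    | 2 => x (-E6.simple 2) + x (-E6.simple 4)
    | 3 => x (-E6.simple 3)
    | _ => x (-E6.simple 6)
  | D4, x, i =>
    let ε : ℂ := Complex.exp (2 * Real.pi * Complex.I / 3)
    match i with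
    | 0 => x D4.thetaZero + ε • x (muBar D4.thetaZero) + ε ^ 2 • x (muBar (muBar D4.thetaZero))
    | 1 => x (-D4.simple 1) + x (-D4.simple 3) + x (-D4.simple 4)
    | _ => x (-D4.simple 2)

/-- The values of `t` that are claimed to work for `F_i`: in type `A_{2l}`, `t = 1` for `i = 0`,
`t = 2` for `1 ≤ i ≤ l - 1` and `t = 4` for `i = l`; in the other types some `t ∈ {1, 2, 3}`. -/
def multipliers : TwistedType → ℕ → Set ℕ
  | Aeven l _, i => if i = 0 then {1} else if i < l then {2} else {4}
  | _, _ => {1, 2, 3}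

end TwistedType

section Setting

variable {𝔤 : Type*} [LieRing 𝔤] [LieAlgebra ℂ 𝔤] [FiniteDimensional ℂ 𝔤]
  [LieAlgebra.IsSimple ℂ 𝔤]

/-- The condition `⟨α, α⟩ = 2` for all roots `α`, where `𝔱` is identified with `𝔱*` by the form:
`u ∈ 𝔱` corresponds to `α` if `⟨u, h⟩ = α(h)` for all `h ∈ 𝔱`, and then `⟨α, α⟩ = α(u)`. -/
def IsNormalized (B : LinearMap.BilinForm ℂ 𝔤) (𝔱 : LieSubalgebra ℂ 𝔤)
    [𝔱.IsCartanSubalgebra] : Prop :=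
  ∀ (α : LieSubalgebra.root (H := 𝔱)) (u : 𝔱),
    (∀ h : 𝔱, B u h = (LieAlgebra.IsKilling.rootSystem 𝔱).root α h) →
      (LieAlgebra.IsKilling.rootSystem 𝔱).root α u = 2

/-- The element `∑ γ_p α_p` of `𝔱*`, for an enumerated base `α_1, …, α_n`. -/
def rootCombination {𝔱 : LieSubalgebra ℂ 𝔤} [𝔱.IsCartanSubalgebra] {n : ℕ}
    {b : (LieAlgebra.IsKilling.rootSystem 𝔱).Base} (enum : Fin n ≃ b.support) (γ : Fin n → ℤ) :
    Module.Dual ℂ 𝔱 :=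
  ∑ p, γ p • (LieAlgebra.IsKilling.rootSystem 𝔱).root (enum p)

/-- A simple Lie algebra `𝔤` with Cartan subalgebra `𝔱`, of one of the five types, together with
an enumerated base of its root system, a diagram automorphism `μ` and compatible root vectors.
(`μ h_α = h_{μ̄ α}` for `h_α = [x_α, x_{-α}]` follows from `mu_rootVec`.) -/
structure TwistedDatum (X : TwistedType) (𝔱 : LieSubalgebra ℂ 𝔤) [𝔱.IsCartanSubalgebra] where
  /-- A base of the root system of `𝔤` with respect to `𝔱`. -/
  base : (LieAlgebra.IsKilling.rootSystem 𝔱).Base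
  /-- The enumeration of the simple roots. -/
  enum : Fin X.rank ≃ base.support
  cartan_eq : ∀ i j, base.cartanMatrix (enum i) (enum j) = X.cartan i j
  /-- The root vectors `x_α`; only the values at roots matter. -/
  rootVec : X.Lattice → 𝔤
  /-- `x_α ∈ 𝔤_α`. -/
  rootVec_mem : ∀ (γ : X.Lattice) (α : LieSubalgebra.root (H := 𝔱)),
    (LieAlgebra.IsKilling.rootSystem 𝔱).root α = rootCombination enum γ →
    rootVec γ ∈ LieAlgebra.rootSpace 𝔱 ((LieAlgebra.IsKilling.rootSystem 𝔱).root α)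
  /-- `[x_α, x_{-α}] = h_α`, the element with `α(h_α) = 2`. -/
  lie_rootVec : ∀ (γ : X.Lattice) (α : LieSubalgebra.root (H := 𝔱)),
    (LieAlgebra.IsKilling.rootSystem 𝔱).root α = rootCombination enum γ →
    ⁅rootVec γ, rootVec (-γ)⁆ = ((LieAlgebra.IsKilling.rootSystem 𝔱).coroot α : 𝔤)
  /-- The diagram automorphism. -/
  mu : 𝔤 ≃ₗ⁅ℂ⁆ 𝔤
  mu_rootVec : ∀ (γ : X.Lattice) (α : LieSubalgebra.root (H := 𝔱)),
    (LieAlgebra.IsKilling.rootSystem 𝔱).root α = rootCombination enum γ →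
    mu (rootVec γ) = X.sign γ • rootVec (TwistedType.muBar γ)

/-- The element `F_i` of `𝔤`, `0 ≤ i ≤ l`. -/
def TwistedDatum.F {X : TwistedType} {𝔱 : LieSubalgebra ℂ 𝔤} [𝔱.IsCartanSubalgebra]
    (T : TwistedDatum X 𝔱) (i : ℕ) : 𝔤 :=
  X.F T.rootVec i

end Setting

end TwistedAffine

end

noncomputable section

namespace TwistedAffine

/-! ### Operators acting nilpotently on a vector modulo a submodule. -/

section Powers

variable {A M : Type*} [Ring A] [AddCommGroup M] [Module A M]

/-! The algebra is simply laced and the form is normalized, so every root vector `e` is extremal: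
`[e, [e, x]] = -2⟨e, x⟩e`. A direct commutation computation then shows that every `x(n)` with `n ≥
1` kills `e(-1)^(k+1) 𝟏` (`IsVacuum.isSingular`). This vector has `d`-degree `-(k+1)`, so the
submodule it generates lives in negative degrees. If `𝟏 ≠ 0`, that submodule misses `𝟏` and is
proper (`IsSingular.mem_sSup_proper`). Thus `t = 1` works for a single root vector.

All the `F_i`, except `F_l` for `A_{2l}`, are linear combinations of one, two or three pairwise
commuting root vectors. By the binomial theorem the multipliers add up (`AnnihilatesVacuum.add`), so
the number of summands serves as `t`. Commutation is read off from the Cartan matrix: two root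
vectors commute as soon as their roots have nonnegative inner product.

For `F_l` in `A_{2l}` the two roots have inner product `-1`, and the bracket of the two root vectors
commutes with both. Normal ordering in the resulting Heisenberg algebra gives some power of
`F_l(-1)` that sends `𝟏` into the maximal submodule (`heisenberg_add_pow_smul_mem`). Moreover `F_l`
is the lowering element of the principal `sl₂` of a copy of `sl₃`, and for the shifted triple `e(1),
h(0) + 4c, f(-1)` the vacuum is a highest weight vector of weight `4k`. Highest weight theory then
lowers the exponent to `4k + 1` (`pow_smul_mem_of_nilpotent`).

That the vectors in question are indexed by roots is checked by applying simple reflections,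
starting from simple roots. -/

theorem pow_smul_mem_of_le (W : Submodule A M) {f : A} {v : M} {m n : ℕ} (h : m ≤ n)
    (hm : f ^ m • v ∈ W) : f ^ n • v ∈ W := by
  obtain ⟨p, rfl⟩ := Nat.exists_eq_add_of_le' h
  rw [pow_add, mul_smul]
  exact W.smul_mem _ hm

/-- In each term of the binomial expansion the exponent of `f` exceeds `p` or that of `g` exceeds
`q`. The factor with the large exponent is moved next to `v`. -/
theorem add_pow_smul_mem (W : Submodule A M) {f g : A} (hfg : Commute f g) {v : M} {p q n : ℕ}
    (hf : ∀ i ≥ p + 1, f ^ i • v ∈ W) (hg : ∀ i ≥ q + 1, g ^ i • v ∈ W) (hn : p + q + 1 ≤ n) :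
    (f + g) ^ n • v ∈ W := by
  rw [hfg.add_pow, Finset.sum_smul]
  refine W.sum_mem fun i hi => ?_
  rw [Finset.mem_range] at hi
  rw [((n.choose i).cast_commute (f ^ i * g ^ (n - i))).symm.eq, mul_smul]
  refine W.smul_mem _ ?_
  rcases le_or_gt (p + 1) i with h | h
  · rw [(hfg.pow_pow i (n - i)).eq, mul_smul]
    exact W.smul_mem _ (hf i h)
  · rw [mul_smul]
    exact W.smul_mem _ (hg _ (by lia))

end Powers

theorem mul_pow_of_commutator {A : Type*} [Ring A] {a b c : A} (hab : a * b = b * a + c)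
    (hcb : Commute c b) (n : ℕ) :
    a * b ^ (n + 1) = b ^ (n + 1) * a + (n + 1) • (c * b ^ n) := by
  induction n with
  | zero => simpa using hab
  | succ n ih =>
    rw [pow_succ b (n + 1), ← mul_assoc, ih, add_mul, mul_assoc, hab, smul_mul_assoc, mul_assoc c,
      ← pow_succ, mul_add, ← mul_assoc, add_assoc, (hcb.pow_right (n + 1)).eq.symm,
      succ_nsmul' _ (n + 1)]

/-! ### Commutation computations of `sl₂` type. -/

section Sl2

variable {A M : Type*} [Ring A] [Algebra ℂ A] [AddCommGroup M] [Module ℂ M] [Module A M]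
  [IsScalarTower ℂ A M]

theorem weight_pow_smul {f z : A} {v : M} {a b : ℂ} (hz : z * f = f * z + b • f)
    (hv : z • v = a • v) (r : ℕ) : z • f ^ r • v = (a + b * r) • f ^ r • v := by
  induction r with
  | zero => simpa using hv
  | succ r ih =>
    rw [pow_succ', mul_smul, ← mul_smul z f, hz, add_smul, mul_smul, ih, smul_assoc,
      smul_comm f, ← add_smul]
    push_cast
    ring_nf

/-- The factor is the sum `a + (a + 2b) + ⋯ + (a + 2br)` of the `z`-eigenvalues met while `y` passes
through the powers of `f`. The step `b` is left free: it is `-1` for an `sl₂`-triple and `-⟨e, x⟩`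
in the singular vector computation. -/
theorem raise_pow_smul {f y z : A} {v : M} {a b : ℂ} (hy : y * f = f * y + z)
    (hz : z * f = f * z + (2 * b) • f) (hyv : y • v = 0) (hv : z • v = a • v) (r : ℕ) :
    y • f ^ (r + 1) • v = ((r + 1) * (a + b * r)) • f ^ r • v := by
  induction r with
  | zero => rw [zero_add, pow_one, ← mul_smul, hy, add_smul, mul_smul, hyv]; simp [hv]
  | succ r ih =>
    rw [pow_succ' f (r + 1), mul_smul, ← mul_smul y f, hy, add_smul, mul_smul, ih,
      weight_pow_smul hz hv, smul_comm f, ← mul_smul f, ← pow_succ', ← add_smul]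
    push_cast
    ring_nf

theorem pow_smul_mem_of_smul (W : Submodule A M) {f : A} {v : M} {n : ℕ} (s : ℂ)
    (hf : f ^ n • v ∈ W) : (s • f) ^ n • v ∈ W := by
  rw [smul_pow, smul_assoc]
  exact W.smul_of_tower_mem _ hf

/-- A nilpotent lowering operator of an `sl₂`-triple kills a vector of weight `m` annihilated by
the raising operator after `m + 1` steps. -/
theorem pow_smul_mem_of_nilpotent (W : Submodule A M) {f y z : A} {v : M} {m : ℕ}
    (hy : y * f = f * y + z) (hz : z * f = f * z + (-2 : ℂ) • f) (hyv : y • v = 0)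
    (hv : z • v = (m : ℂ) • v) {n : ℕ} (hn : f ^ n • v ∈ W) : f ^ (m + 1) • v ∈ W := by
  rcases le_or_gt n (m + 1) with h | h
  · exact pow_smul_mem_of_le W h hn
  -- Applying `y` to `f ^ (N + 1) • v` yields `(N + 1)(m - N)` times `f ^ N • v`. This scalar is
  -- nonzero while `N > m`, so the exponent descends one step at a time until it reaches `m + 1`.
  · obtain ⟨p, rfl⟩ := Nat.exists_eq_add_of_lt h
    clear h
    induction p with
    | zero =>
      have h1 := W.smul_mem y hn
      rw [show m + 1 + 0 + 1 = (m + 1) + 1 from rfl,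
        raise_pow_smul hy (b := -1) (by simpa using hz) hyv hv] at h1
      refine (Submodule.smul_mem_iff (S := ℂ) (W.restrictScalars ℂ) ?_).1 h1
      push_cast
      rw [show (m : ℂ) + -1 * (m + 1) = -1 by ring]
      exact mul_ne_zero (by exact_mod_cast (Nat.succ_ne_zero (m + 1))) (by norm_num)
    | succ p ih =>
      apply ih
      have h1 := W.smul_mem y hn
      rw [show m + 1 + (p + 1) + 1 = (m + 1 + p + 1) + 1 from rfl,
        raise_pow_smul hy (b := -1) (by simpa using hz) hyv hv] at h1
      refine (Submodule.smul_mem_iff (S := ℂ) (W.restrictScalars ℂ) ?_).1 h1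
      push_cast
      rw [show (m : ℂ) + -1 * (m + 1 + p + 1) = -(p + 2) by ring]
      exact mul_ne_zero (by exact_mod_cast (Nat.succ_ne_zero (m + 1 + p + 1)))
        (neg_ne_zero.2 (by exact_mod_cast (Nat.succ_ne_zero (p + 1))))

end Sl2

/-! ### Sums of two nilpotent operators in a Heisenberg algebra. -/

section Heisenberg

variable {A M : Type*} [Ring A] [Algebra ℂ A] [AddCommGroup M] [Module ℂ M] [Module A M]
  [IsScalarTower ℂ A M]

/-- Powers of `b` are traded for powers of `c`: commuting `a` past `b ^ (n + 1)` expresses `(n + 1)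
c ^ (s + 1) b ^ n a ^ j` through two monomials with one `c` fewer and one `b` more. So `n + s` is
unchanged along the induction on `s`, and it remains to divide by `n + 1`. -/
theorem heisenberg_pow_mul_smul_mem (W : Submodule A M) {a b c : A} (hab : a * b = b * a + c)
    (hca : Commute c a) (hcb : Commute c b) {v : M} {p : ℕ} (ha : ∀ j ≥ p, a ^ j • v ∈ W)
    (hb : ∀ j ≥ p, b ^ j • v ∈ W) (s : ℕ) :
    ∀ n j, 2 * p ≤ n + s → (c ^ s * (b ^ n * a ^ j)) • v ∈ W := by
  have step (s n j : ℕ) : (c ^ s * (b ^ (n + 1) * a ^ (j + 1))) • v =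
      (a * (c ^ s * (b ^ (n + 1) * a ^ j))) • v -
        (n + 1) • (c ^ (s + 1) * (b ^ n * a ^ j)) • v := by
    rw [← smul_assoc, ← sub_smul]
    congr 1
    rw [← mul_assoc a, (hca.pow_left s).eq.symm, mul_assoc (c ^ s), ← mul_assoc a,
      mul_pow_of_commutator hab hcb, pow_succ' a, pow_succ c, add_mul, mul_add, smul_mul_assoc,
      mul_smul_comm]
    simp only [mul_assoc, add_sub_cancel_right]
  induction s with
  | zero =>
    -- For small `j` the powers of `a` are brought in one by one. Each costs one power of `b`, lost
    -- in the commutator term.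
    have key (j : ℕ) : ∀ n ≥ p + j, (b ^ n * a ^ j) • v ∈ W := by
      induction j with
      | zero => intro n hn; simpa using hb n hn
      | succ j ih =>
        intro n hn
        obtain ⟨n, rfl⟩ : ∃ m, n = m + 1 := ⟨n - 1, by lia⟩
        have := step 0 n j
        rw [pow_zero, one_mul, one_mul, zero_add, pow_one] at this
        rw [this]
        refine W.sub_mem ?_ (W.smul_of_tower_mem _ ?_)
        · rw [mul_smul]; exact W.smul_mem _ (ih _ (by lia))
        · rw [mul_smul]; exact W.smul_mem _ (ih _ (by lia))
    intro n j h
    rw [pow_zero, one_mul]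
    rcases le_or_gt p j with hj | hj
    · rw [mul_smul]; exact W.smul_mem _ (ha j hj)
    · exact key j n (by lia)
  | succ s ih =>
    intro n j h
    have h1 := ih (n + 1) (j + 1) (by lia)
    have h2 : (a * (c ^ s * (b ^ (n + 1) * a ^ j))) • v ∈ W := by
      rw [mul_smul]; exact W.smul_mem _ (ih (n + 1) j (by lia))
    rw [step] at h1
    have h3 : (n + 1) • (c ^ (s + 1) * (b ^ n * a ^ j)) • v ∈ W := by
      simpa using W.sub_mem h2 h1
    rw [← Nat.cast_smul_eq_nsmul ℂ] at h3
    exact (Submodule.smul_mem_iff (S := ℂ) (W.restrictScalars ℂ)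
      (by exact_mod_cast Nat.succ_ne_zero n)).1 h3

/-- If `c = [a, b]` commutes with `a` and `b`, and `a`, `b` act nilpotently on `v` modulo `W`, then
so does `a + b`. -/
theorem heisenberg_add_pow_smul_mem (W : Submodule A M) {a b c : A} (hab : a * b = b * a + c)
    (hca : Commute c a) (hcb : Commute c b) {v : M} {p : ℕ} (ha : ∀ j ≥ p, a ^ j • v ∈ W)
    (hb : ∀ j ≥ p, b ^ j • v ∈ W) : (a + b) ^ (5 * p) • v ∈ W := by
  -- Normally ordered monomials of weight `n`, where `a` and `b` have weight `1` and `c = [a, b]`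
  -- has weight `2`. Reordering preserves the weight and produces only natural coefficients.
  let P (n : ℕ) : AddSubmonoid A := AddSubmonoid.closure
    {x | ∃ s i j, i + j + 2 * s = n ∧ x = c ^ s * (b ^ i * a ^ j)}
  have hP (n : ℕ) : (a + b) ^ n ∈ P n := by
    induction n with
    | zero => exact AddSubmonoid.subset_closure ⟨0, 0, 0, by simp⟩
    | succ n ih =>
      rw [pow_succ']
      generalize (a + b) ^ n = x at ih ⊢
      induction ih using AddSubmonoid.closure_induction with
      | zero => rw [mul_zero]; exact zero_mem _
      | add x y _ _ hx hy => rw [mul_add]; exact add_mem hx hy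
      | mem x hx =>
        obtain ⟨s, i, j, h, rfl⟩ := hx
        rw [add_mul]
        refine add_mem ?_ (AddSubmonoid.subset_closure ⟨s, i + 1, j, by lia, ?_⟩)
        · rw [← mul_assoc a, (hca.pow_left s).eq.symm, mul_assoc]
          cases i with
          | zero => exact AddSubmonoid.subset_closure ⟨s, 0, j + 1, by lia, by simp [pow_succ']⟩
          | succ i =>
            rw [← mul_assoc a, mul_pow_of_commutator hab hcb, add_mul, mul_add, smul_mul_assoc,
              mul_smul_comm]
            have h1 : c ^ s * (b ^ (i + 1) * a ^ (j + 1)) ∈ P (n + 1) :=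
              AddSubmonoid.subset_closure ⟨s, i + 1, j + 1, by lia, rfl⟩
            have h2 : c ^ (s + 1) * (b ^ i * a ^ j) ∈ P (n + 1) :=
              AddSubmonoid.subset_closure ⟨s + 1, i, j, by lia, rfl⟩
            convert add_mem h1 ((P (n + 1)).nsmul_mem h2 (i + 1)) using 2
            · rw [pow_succ' a, mul_assoc]
            · rw [pow_succ c]; simp only [mul_assoc]
        · rw [← mul_assoc b, (hcb.pow_left s).eq.symm, pow_succ']; simp only [mul_assoc]
  have := hP (5 * p)
  generalize (a + b) ^ (5 * p) = x at this ⊢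
  induction this using AddSubmonoid.closure_induction with
  | zero => rw [zero_smul]; exact zero_mem _
  | add x y _ _ hx hy => rw [add_smul]; exact add_mem hx hy
  | mem x hx =>
    obtain ⟨s, i, j, h, rfl⟩ := hx
    rcases le_or_gt p j with hj | hj
    · rw [mul_smul, mul_smul]
      exact W.smul_mem _ (W.smul_mem _ (ha j hj))
    -- Here `j < p` and `i + j + 2s = 5p`, so `2(i + s) ≥ i + 2s > 4p`. This is where the exponent
    -- `5p` comes from.
    · exact heisenberg_pow_mul_smul_mem W hab hca hcb ha hb s i j (by lia)

end Heisenberg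

/-! ### Singular vectors in modules over the affine algebra. -/

section Generators

variable {𝔤 : Type*} [LieRing 𝔤] [LieAlgebra ℂ 𝔤]

/-- A realization of the affine Lie algebra attached to `B` by generators of an algebra `A`. -/
structure AffineGenerators (B : LinearMap.BilinForm ℂ 𝔤) (A : Type*) [Ring A] [Algebra ℂ A] where
  /-- `x(n)` -/
  X : ℤ → 𝔤 →ₗ[ℂ] A
  /-- The central element. -/
  c : A
  /-- The degree element. -/
  d : A
  mul_comm : ∀ m n x y, X m x * X n y = X n y * X m x + X (m + n) ⁅x, y⁆ +
    (if m + n = 0 then (m : ℂ) * B x y else 0) • c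
  d_mul : ∀ n x, d * X n x = X n x * d + (n : ℂ) • X n x
  c_comm : ∀ a, Commute c a
  adjoin_eq_top : Algebra.adjoin ℂ ({c, d} ∪ {a | ∃ n x, a = X n x}) = ⊤

/-- An element `e` with `[e, [e, x]] = -2 ⟨e, x⟩ e`, as the root vectors of a long root. -/
structure IsExtremal (B : LinearMap.BilinForm ℂ 𝔤) (e : 𝔤) : Prop where
  self : B e e = 0
  lie_lie : ∀ x, ⁅e, ⁅e, x⁆⁆ = (-2 * B e x) • e

variable {B : LinearMap.BilinForm ℂ 𝔤} {A : Type*} [Ring A] [Algebra ℂ A]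
  (G : AffineGenerators B A) {M : Type*} [AddCommGroup M] [Module ℂ M] [Module A M]
  [IsScalarTower ℂ A M]

/-- A vector spanning the one-dimensional module of level `k` of the nonnegative part. -/
structure AffineGenerators.IsVacuum (k : ℂ) (v : M) : Prop where
  X_smul : ∀ n x, 0 ≤ n → G.X n x • v = 0
  c_smul : G.c • v = k • v
  d_smul : G.d • v = 0

/-- A vector of degree `r` and level `k` annihilated by all `x(n)` with `n ≥ 1`. -/
structure AffineGenerators.IsSingular (k r : ℂ) (v : M) : Prop where
  X_smul : ∀ n x, 1 ≤ n → G.X n x • v = 0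
  c_smul : G.c • v = k • v
  d_smul : G.d • v = r • v

namespace AffineGenerators

variable {G}

/-- The commutator of `y(n)` and `x(0)` is `[y, x](n)`, again a positive mode and without central
term. Hence descendants may be built from negative modes alone, zero modes being absorbed into the
singular vector. -/
theorem IsSingular.X_zero_smul {k r : ℂ} {v : M} (hv : G.IsSingular k r v) (x : 𝔤) :
    G.IsSingular k r (G.X 0 x • v) where
  X_smul n y hn := by
    rw [← mul_smul, G.mul_comm, if_neg (by lia)]
    simp [add_smul, mul_smul, hv.X_smul n _ hn]
  c_smul := by
    rw [← mul_smul, (G.c_comm _).eq, mul_smul, hv.c_smul, smul_comm]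
  d_smul := by
    rw [← mul_smul, G.d_mul]
    simp [mul_smul, hv.d_smul, smul_comm r]

variable (G) in
/-- The vectors `x₁(-n₁) ⋯ xₛ(-nₛ) w`, with `w` singular of degree `r` and `∑ nᵢ = m`. -/
inductive Descendant (k r : ℂ) : ℕ → M → Prop
  | singular (w : M) (hw : G.IsSingular k r w) : Descendant k r 0 w
  | lower (m : ℕ) (w : M) (hw : Descendant k r m w) (x : 𝔤) (n : ℕ) :
      Descendant k r (m + (n + 1)) (G.X (-(n + 1 : ℕ)) x • w)

theorem Descendant.c_smul {k r : ℂ} {m : ℕ} {w : M} (hw : G.Descendant k r m w) :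
    G.c • w = k • w := by
  induction hw with
  | singular w hw => exact hw.c_smul
  | lower m w hw x n ih => rw [← mul_smul, (G.c_comm _).eq, mul_smul, ih, smul_comm]

theorem Descendant.d_smul {k r : ℂ} {m : ℕ} {w : M} (hw : G.Descendant k r m w) :
    G.d • w = (r - m) • w := by
  induction hw with
  | singular w hw => simpa using hw.d_smul
  | lower m w hw x n ih =>
    rw [← mul_smul, G.d_mul, add_smul, mul_smul, ih, smul_comm, smul_assoc, ← add_smul]
    push_cast
    ring_nf

theorem generators_induction {p : A → Prop} (a : A) (hX : ∀ n x, p (G.X n x)) (hc : p G.c)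
    (hd : p G.d) (hr : ∀ r : ℂ, p (algebraMap ℂ A r)) (hadd : ∀ a b, p a → p b → p (a + b))
    (hmul : ∀ a b, p a → p b → p (a * b)) : p a := by
  have : a ∈ Algebra.adjoin ℂ ({G.c, G.d} ∪ {a | ∃ n x, a = G.X n x}) :=
    G.adjoin_eq_top ▸ Algebra.mem_top
  induction this using Algebra.adjoin_induction with
  | mem x hx =>
    rcases hx with (rfl | rfl) | ⟨n, x, rfl⟩
    exacts [hc, hd, hX n x]
  | algebraMap r => exact hr r
  | add x y _ _ hx hy => exact hadd _ _ hx hy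
  | mul x y _ _ hx hy => exact hmul _ _ hx hy

variable (G M) in
/-- The span of all descendants of singular vectors of degree `r` and level `k`. -/
def descendantSpan (k r : ℂ) : Submodule ℂ M :=
  Submodule.span ℂ {w | ∃ m, G.Descendant k r m w}

theorem X_neg_smul_mem_descendantSpan {k r : ℂ} {w : M} (hw : w ∈ G.descendantSpan M k r) (x : 𝔤)
    (n : ℕ) : G.X (-(n + 1 : ℕ)) x • w ∈ G.descendantSpan M k r := by
  induction hw using Submodule.span_induction with
  | mem w hw =>
    obtain ⟨m, hw⟩ := hw
    exact Submodule.subset_span ⟨_, hw.lower m w x n⟩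
  | zero => rw [smul_zero]; exact zero_mem _
  | add a b _ _ ha hb => rw [smul_add]; exact add_mem ha hb
  | smul s a _ ha => rw [smul_comm]; exact Submodule.smul_mem _ _ ha

/-- Commuting `x(n)` past the outermost factor leaves modes acting on a shorter descendant, plus a
multiple of that descendant. The induction must therefore allow all modes at once. -/
theorem Descendant.X_smul_mem {k r : ℂ} {m : ℕ} {w : M} (hw : G.Descendant k r m w) (n : ℤ)
    (x : 𝔤) : G.X n x • w ∈ G.descendantSpan M k r := by
  induction hw generalizing n x with
  | singular w hw =>
    rcases lt_trichotomy n 0 with h | rfl | h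
    · obtain ⟨j, rfl⟩ : ∃ j : ℕ, n = -(j + 1 : ℕ) := ⟨(-n - 1).toNat, by lia⟩
      exact X_neg_smul_mem_descendantSpan (Submodule.subset_span ⟨0, .singular w hw⟩) x j
    · exact Submodule.subset_span ⟨0, .singular _ (hw.X_zero_smul x)⟩
    · rw [hw.X_smul n x h]; exact zero_mem _
  | lower m w hw y j ih =>
    rw [← mul_smul, G.mul_comm, add_smul, add_smul, mul_smul, smul_assoc, hw.c_smul]
    refine add_mem (add_mem (X_neg_smul_mem_descendantSpan (ih n x) y j) (ih _ _))
      (Submodule.smul_mem _ _ (Submodule.smul_mem _ _ (Submodule.subset_span ⟨m, hw⟩)))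

theorem smul_mem_descendantSpan {k r : ℂ} {w : M} (hw : w ∈ G.descendantSpan M k r) (a : A) :
    a • w ∈ G.descendantSpan M k r := by
  induction a using G.generators_induction generalizing w with
  | hX n x =>
    induction hw using Submodule.span_induction with
    | mem w hw => exact hw.choose_spec.X_smul_mem n x
    | zero => rw [smul_zero]; exact zero_mem _
    | add a b _ _ ha hb => rw [smul_add]; exact add_mem ha hb
    | smul s a _ ha => rw [smul_comm]; exact Submodule.smul_mem _ _ ha
  | hc =>
    induction hw using Submodule.span_induction with
    | mem w hw =>
      rw [hw.choose_spec.c_smul]; exact Submodule.smul_mem _ _ (Submodule.subset_span hw)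
    | zero => rw [smul_zero]; exact zero_mem _
    | add a b _ _ ha hb => rw [smul_add]; exact add_mem ha hb
    | smul s a _ ha => rw [smul_comm]; exact Submodule.smul_mem _ _ ha
  | hd =>
    induction hw using Submodule.span_induction with
    | mem w hw =>
      rw [hw.choose_spec.d_smul]; exact Submodule.smul_mem _ _ (Submodule.subset_span hw)
    | zero => rw [smul_zero]; exact zero_mem _
    | add a b _ _ ha hb => rw [smul_add]; exact add_mem ha hb
    | smul s a _ ha => rw [smul_comm]; exact Submodule.smul_mem _ _ ha
  | hr s => rw [algebraMap_smul]; exact Submodule.smul_mem _ _ hw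
  | hadd a b ha hb => rw [add_smul]; exact add_mem (ha hw) (hb hw)
  | hmul a b ha hb => rw [mul_smul]; exact ha (hb hw)

/-- A singular vector of negative degree generates a proper submodule. -/
theorem IsSingular.mem_sSup_proper {k : ℂ} {v w : M} {r : ℕ} (hv : G.IsVacuum k v)
    (hw : G.IsSingular k (-(r + 1 : ℕ)) w) (hvw : v = 0 → w = 0) :
    w ∈ sSup {W : Submodule A M | W ≠ ⊤} := by
  let W : Submodule A M :=
    { (G.descendantSpan M k (-(r + 1 : ℕ))) with
      smul_mem' := fun a w hw => smul_mem_descendantSpan hw a }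
  -- This case makes it unnecessary to know that the vacuum vector is nonzero.
  rcases eq_or_ne v 0 with rfl | hv0
  · rw [hvw rfl]; exact zero_mem _
  have hwW : w ∈ W := Submodule.subset_span ⟨0, .singular w hw⟩
  have hmem (h : W ≠ ⊤) : w ∈ sSup {W : Submodule A M | W ≠ ⊤} :=
    le_sSup (show W ∈ {W : Submodule A M | W ≠ ⊤} from h) hwW
  refine hmem fun h => hv0 ?_
  let D : Module.End ℂ M := Algebra.lsmul ℂ ℂ M G.d
  -- Every descendant has strictly negative `d`-degree while `v` has degree `0`. Independence of
  -- eigenspaces forces `v = 0` if the span is everything.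
  have hW : G.descendantSpan M k (-(r + 1 : ℕ)) ≤ ⨆ μ ≠ (0 : ℂ), D.eigenspace μ := by
    refine Submodule.span_le.2 ?_
    rintro x ⟨m, hx⟩
    refine (le_iSup₂_of_le (-(r + 1 : ℕ) - m : ℂ) ?_ le_rfl :
      D.eigenspace (-(r + 1 : ℕ) - m : ℂ) ≤ _) ?_
    · rw [← neg_add', neg_ne_zero]
      exact_mod_cast (by lia)
    · exact Module.End.mem_eigenspace_iff.2 hx.d_smul
  have h0 : v ∈ D.eigenspace 0 := by
    rw [Module.End.mem_eigenspace_iff, zero_smul]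
    exact hv.d_smul
  have h1 : v ∈ W := h ▸ Submodule.mem_top
  exact Submodule.disjoint_def.1 (D.eigenspaces_iSupIndep 0) v h0 (hW h1)

/-- If `e` is extremal, then `e(-1)^(k+1) 𝟏` is a singular vector. -/
theorem IsVacuum.isSingular (hB : B.lieInvariant 𝔤) (hs : B.IsSymm) {k : ℕ} {v : M}
    (hv : G.IsVacuum k v) {e : 𝔤} (he : IsExtremal B e) :
    G.IsSingular k (-(k + 1 : ℕ)) (G.X (-1) e ^ (k + 1) • v) where
  X_smul n x hn := by
    have h1 : B ⁅x, e⁆ e = 0 := by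
      have h2 : B e ⁅x, e⁆ = B ⁅x, e⁆ e := hs.eq e ⁅x, e⁆
      linear_combination (hB x e e - h2) / 2
    have hy : G.X n x * G.X (-1) e = G.X (-1) e * G.X n x +
        (G.X (n - 1) ⁅x, e⁆ + (if n = 1 then B x e else 0) • G.c) := by
      rw [G.mul_comm, add_assoc, ← sub_eq_add_neg]
      rcases eq_or_ne n 1 with rfl | h
      · simp
      · rw [if_neg (by lia), if_neg h]
    have hz : (G.X (n - 1) ⁅x, e⁆ + (if n = 1 then B x e else 0) • G.c) * G.X (-1) e =
        G.X (-1) e * (G.X (n - 1) ⁅x, e⁆ + (if n = 1 then B x e else 0) • G.c) +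
        (-2 * B e x) • G.X (n - 2) e := by
      rw [add_mul, mul_add, smul_mul_assoc, mul_smul_comm, (G.c_comm _).eq, G.mul_comm, h1,
        mul_zero, ite_self, zero_smul, add_zero, ← lie_skew ⁅x, e⁆ e, ← lie_skew x e, lie_neg,
        neg_neg, he.lie_lie, map_smul, show n - 1 + -1 = n - 2 by ring]
      abel
    -- For `n = 1`, `raise_pow_smul` gives the factor `(k + 1)(⟨x, e⟩k - ⟨e, x⟩k) = 0`, which
    -- singles out the exponent `k + 1`. For `n ≥ 2` any exponent works: commutators with `e(-1)`
    -- lead from `x(n)` to `[x, e](n - 1)` to `e(n - 2)`, all of them nonnegative modes.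
    rcases eq_or_lt_of_le hn with rfl | hn
    · rw [if_pos rfl] at hy hz
      rw [raise_pow_smul hy (a := B x e * k) (b := -B e x) (by simpa using hz)
        (hv.X_smul _ _ zero_le_one) (by simp [add_smul, hv.X_smul, hv.c_smul, mul_smul]),
        hs.eq x e]
      simp
    · rw [if_neg hn.ne', zero_smul, add_zero] at hy hz
      have hV (r : ℕ) : G.X (n - 2) e • G.X (-1) e ^ r • v = 0 := by
        -- A central term could arise only at `n = 3`, and there it vanishes because `⟨e, e⟩ = 0`.
        have : Commute (G.X (n - 2) e) (G.X (-1) e) := by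
          rw [commute_iff_eq, G.mul_comm, lie_self, he.self]
          simp
        rw [← mul_smul, (this.pow_right r).eq, mul_smul, hv.X_smul _ _ (by lia), smul_zero]
      have hZ (r : ℕ) : G.X (n - 1) ⁅x, e⁆ • G.X (-1) e ^ r • v = 0 := by
        induction r with
        | zero => rw [pow_zero, one_smul, hv.X_smul _ _ (by lia)]
        | succ r ih =>
          rw [pow_succ', mul_smul, ← mul_smul (G.X (n - 1) _), hz, add_smul, mul_smul, ih,
            smul_assoc, hV, smul_zero, smul_zero, add_zero]
      generalize k + 1 = r
      induction r with
      | zero => rw [pow_zero, one_smul, hv.X_smul _ _ (by lia)]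
      | succ r ih =>
        rw [pow_succ', mul_smul, ← mul_smul (G.X n x), hy, add_smul, mul_smul, ih, hZ, smul_zero,
          add_zero]
  c_smul := by rw [← mul_smul, (G.c_comm _).eq, mul_smul, hv.c_smul, smul_comm]
  d_smul := by
    have hd : G.d * G.X (-1) e = G.X (-1) e * G.d + (-1 : ℂ) • G.X (-1) e := by
      simpa using G.d_mul (-1) e
    have hv0 : G.d • v = (0 : ℂ) • v := by rw [hv.d_smul, zero_smul]
    simpa using weight_pow_smul hd hv0 (k + 1)

theorem IsVacuum.pow_smul_mem (hB : B.lieInvariant 𝔤) (hs : B.IsSymm) {k : ℕ} {v : M}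
    (hv : G.IsVacuum k v) {e : 𝔤} (he : IsExtremal B e) {n : ℕ} (hn : k + 1 ≤ n) :
    G.X (-1) e ^ n • v ∈ sSup {W : Submodule A M | W ≠ ⊤} :=
  pow_smul_mem_of_le _ hn <|
    (hv.isSingular hB hs he).mem_sSup_proper hv (by rintro rfl; exact smul_zero _)

end AffineGenerators
end Generators

section Generators

variable {𝔤 : Type*} [LieRing 𝔤] [LieAlgebra ℂ 𝔤]
  {B : LinearMap.BilinForm ℂ 𝔤} {A : Type*} [Ring A] [Algebra ℂ A]
  {G : AffineGenerators B A} {M : Type*} [AddCommGroup M] [Module ℂ M] [Module A M]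
  [IsScalarTower ℂ A M]

namespace AffineGenerators

theorem commute_X {x y : 𝔤} (h : ⁅x, y⁆ = 0) {m n : ℤ} (hmn : m + n ≠ 0) :
    Commute (G.X m x) (G.X n y) := by
  rw [commute_iff_eq, G.mul_comm, h, if_neg hmn]
  simp

/-- The operators `e(1)`, `h(0) + mc`, `f(-1)` satisfy the relations needed for lowering the
exponent. The vacuum has weight `mk` for the middle one, since `h(0)` kills it and `c` acts by `k`.
-/
theorem IsVacuum.sl2_pow_smul_mem {k : ℕ} {v : M} (hv : G.IsVacuum k v) (W : Submodule A M)
    {e h f : 𝔤} {m : ℕ} (hef : ⁅e, f⁆ = h) (hhf : ⁅h, f⁆ = (-2 : ℂ) • f) (hB : B e f = m) {n : ℕ}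
    (hn : G.X (-1) f ^ n • v ∈ W) : G.X (-1) f ^ (m * k + 1) • v ∈ W := by
  refine pow_smul_mem_of_nilpotent W (y := G.X 1 e) (z := G.X 0 h + (m : ℂ) • G.c) ?_ ?_
    (hv.X_smul _ _ zero_le_one) ?_ hn
  · rw [G.mul_comm, hef, hB]
    simp [add_assoc]
  · rw [add_mul, mul_add, smul_mul_assoc, mul_smul_comm, (G.c_comm _).eq, G.mul_comm, hhf]
    simp only [map_smul]
    simp
    abel
  · simp [add_smul, hv.X_smul, smul_assoc, hv.c_smul, mul_smul]

/-- Extremality and `⟨e, f⟩ = 0` make `[e, f]` commute with `e` and `f`, so `e(-1)`, `f(-1)` and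
`[e, f](-2)` satisfy Heisenberg relations. The bound is crude; only nilpotency matters. -/
theorem IsVacuum.extremal_add_nilpotent (hB : B.lieInvariant 𝔤) (hs : B.IsSymm) {k : ℕ} {v : M}
    (hv : G.IsVacuum k v) {e f : 𝔤} (he : IsExtremal B e) (hf : IsExtremal B f)
    (hef : B e f = 0) :
    G.X (-1) (e + f) ^ (5 * (k + 1)) • v ∈ sSup {W : Submodule A M | W ≠ ⊤} := by
  have h1 : ⁅e, ⁅e, f⁆⁆ = 0 := by rw [he.lie_lie, hef, mul_zero, zero_smul]
  have h2 : ⁅f, ⁅e, f⁆⁆ = 0 := by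
    rw [← lie_skew e f, lie_neg, hf.lie_lie, hs.eq f e]
    simp [hef]
  rw [map_add]
  refine heisenberg_add_pow_smul_mem _ (c := G.X (-2) ⁅e, f⁆) ?_ (commute_X h1 (by lia)).symm
    (commute_X h2 (by lia)).symm (fun j hj => hv.pow_smul_mem hB hs he hj)
    (fun j hj => hv.pow_smul_mem hB hs hf hj)
  rw [G.mul_comm, if_neg (by lia), zero_smul, add_zero]
  rfl

end AffineGenerators

end Generators

/-! ### The enveloping algebra and the vacuum module as an instance. -/

section Concrete

attribute [local instance 100] LieRing.ofAssociativeRing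

variable {𝔤 : Type*} [LieRing 𝔤] [LieAlgebra ℂ 𝔤]
  (B : LinearMap.BilinForm ℂ 𝔤) (hB : B.lieInvariant 𝔤) (hs : B.IsSymm)

/-- `x ↦ x(n)` as a linear map. -/
def monomialₗ (n : ℤ) : 𝔤 →ₗ[ℂ] AffineTilde B hB hs where
  toFun x := monomial B hB hs x n
  map_add' x y := by
    refine LieAlgebra.SemiDirectSum.ext ?_ (add_zero _).symm
    refine congrArg (LieAlgebra.ofProd (affineCocycle B hB hs)) (Prod.ext ?_ (add_zero _).symm)
    exact TensorProduct.tmul_add _ _ _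
  map_smul' r x := by
    refine LieAlgebra.SemiDirectSum.ext ?_ (smul_zero r).symm
    refine congrArg (LieAlgebra.ofProd (affineCocycle B hB hs)) (Prod.ext ?_ (smul_zero r).symm)
    exact TensorProduct.tmul_smul _ _ _

theorem affineTilde_induction {p : AffineTilde B hB hs → Prop} (y : AffineTilde B hB hs)
    (hm : ∀ n x, p (monomial B hB hs x n)) (hc : p (central B hB hs)) (hd : p (degree B hB hs))
    (hadd : ∀ a b, p a → p b → p (a + b)) (hsmul : ∀ (r : ℂ) a, p a → p (r • a)) : p y := by
  have h0 : p 0 := by simpa using hsmul 0 _ hd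
  obtain ⟨⟨⟨f, u⟩⟩, z⟩ := y
  have hf : p ⟨LieAlgebra.ofProd _ (f, 0), 0⟩ := by
    induction f using loop_induction with
    | h0 => exact h0
    | hadd a b ha hb =>
      convert hadd _ _ ha hb using 1
      refine LieAlgebra.SemiDirectSum.ext ?_ (add_zero _).symm
      exact congrArg (LieAlgebra.ofProd (affineCocycle B hB hs)) (Prod.ext rfl (add_zero _).symm)
    | hm x n => exact hm n x
  convert hadd _ _ hf (hadd _ _
    (hsmul (TrivialLieModule.equiv ℂ (LieAlgebra.loopAlgebra ℂ ℤ 𝔤) ℂ u) _ hc) (hsmul z _ hd)) using 1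
  refine LieAlgebra.SemiDirectSum.ext ?_ ?_
  · refine congrArg (LieAlgebra.ofProd (affineCocycle B hB hs)) (Prod.ext ?_ ?_)
    · change f = f + ((_ : ℂ) • (0 : LieAlgebra.loopAlgebra ℂ ℤ 𝔤) + z • 0)
      simp
    · change u = 0 + ((TrivialLieModule.equiv ℂ (LieAlgebra.loopAlgebra ℂ ℤ 𝔤) ℂ u) •
        (TrivialLieModule.equiv ℂ (LieAlgebra.loopAlgebra ℂ ℤ 𝔤) ℂ).symm 1 +
        z • (0 : TrivialLieModule ℂ (LieAlgebra.loopAlgebra ℂ ℤ 𝔤) ℂ))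
      rw [← map_smul]
      simp
  · change z = 0 + (_ • (0 : ℂ) + z • (1 : ℂ))
    simp

/-- By the universal property, `ι` lifts to a map into the subalgebra it generates. Followed by the
inclusion this lift is the identity, so the inclusion is onto. -/
theorem adjoin_range_ι (L : Type*) [LieRing L] [LieAlgebra ℂ L] :
    Algebra.adjoin ℂ (Set.range (UniversalEnvelopingAlgebra.ι ℂ (L := L))) = ⊤ := by
  set S := Algebra.adjoin ℂ (Set.range (UniversalEnvelopingAlgebra.ι ℂ (L := L))) with hS
  let f : L →ₗ⁅ℂ⁆ S :=
    { toFun := fun x => ⟨UniversalEnvelopingAlgebra.ι ℂ x, Algebra.subset_adjoin ⟨x, rfl⟩⟩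
      map_add' := fun x y => Subtype.ext (map_add _ x y)
      map_smul' := fun r x => Subtype.ext (map_smul _ r x)
      map_lie' := fun {x y} => Subtype.ext (LieHom.map_lie _ x y) }
  have h : S.val.comp (UniversalEnvelopingAlgebra.lift ℂ f) = AlgHom.id ℂ _ := by
    apply UniversalEnvelopingAlgebra.hom_ext
    ext x
    simp [f]
  refine eq_top_iff.2 fun a _ => ?_
  have := DFunLike.congr_fun h a
  simp only [AlgHom.comp_apply, AlgHom.id_apply] at this
  rw [← this]
  exact Subtype.property _

theorem ι_mul_ι {L : Type*} [LieRing L] [LieAlgebra ℂ L] (x y : L) :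
    UniversalEnvelopingAlgebra.ι ℂ x * UniversalEnvelopingAlgebra.ι ℂ y =
      UniversalEnvelopingAlgebra.ι ℂ y * UniversalEnvelopingAlgebra.ι ℂ x +
        UniversalEnvelopingAlgebra.ι ℂ ⁅x, y⁆ := by
  rw [LieHom.map_lie, LieRing.of_associative_ring_bracket]
  abel

/-- The standard generators of `U(g̃)`. -/
def envGenerators : AffineGenerators B (Env B hB hs) where
  X n := (UniversalEnvelopingAlgebra.ι ℂ).toLinearMap ∘ₗ monomialₗ B hB hs n
  c := UniversalEnvelopingAlgebra.ι ℂ (central B hB hs)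
  d := UniversalEnvelopingAlgebra.ι ℂ (degree B hB hs)
  mul_comm m n x y := by
    change UniversalEnvelopingAlgebra.ι ℂ (monomial B hB hs x m) *
      UniversalEnvelopingAlgebra.ι ℂ (monomial B hB hs y n) = _
    rw [ι_mul_ι, lie_monomial, map_add, map_smul, ← add_assoc]
    rfl
  d_mul n x := by
    change UniversalEnvelopingAlgebra.ι ℂ (degree B hB hs) *
      UniversalEnvelopingAlgebra.ι ℂ (monomial B hB hs x n) = _
    rw [ι_mul_ι, degree_lie_monomial, map_smul]
    rfl
  c_comm a := by
    have : a ∈ Algebra.adjoin ℂ (Set.range (UniversalEnvelopingAlgebra.ι ℂ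
      (L := AffineTilde B hB hs))) := adjoin_range_ι (AffineTilde B hB hs) ▸ Algebra.mem_top
    refine Algebra.commute_of_mem_adjoin_of_forall_mem_commute this ?_
    rintro _ ⟨y, rfl⟩
    rw [commute_iff_eq, ι_mul_ι, central_lie, map_zero, add_zero]
  adjoin_eq_top := by
    refine eq_top_iff.2 ((adjoin_range_ι (AffineTilde B hB hs)).symm.le.trans
      (Algebra.adjoin_le ?_))
    rintro _ ⟨y, rfl⟩
    induction y using affineTilde_induction B hB hs with
    | hm n x => exact Algebra.subset_adjoin (Or.inr ⟨n, x, rfl⟩)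
    | hc => exact Algebra.subset_adjoin (Or.inl (Or.inl rfl))
    | hd => exact Algebra.subset_adjoin (Or.inl (Or.inr rfl))
    | hadd a b ha hb => rw [map_add]; exact add_mem ha hb
    | hsmul r a ha => rw [map_smul]; exact Subalgebra.smul_mem _ ha r

theorem isVacuum_vacuum (k : ℂ) : (envGenerators B hB hs).IsVacuum k (vacuum B hB hs k) where
  X_smul n x hn := by
    rw [vacuum, ← map_smul, smul_eq_mul, mul_one, Submodule.mkQ_apply,
      Submodule.Quotient.mk_eq_zero]
    exact Submodule.subset_span (Or.inl ⟨x, n, hn, rfl⟩)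
  c_smul := by
    rw [vacuum, ← map_smul, smul_eq_mul, mul_one, Submodule.mkQ_apply, Submodule.mkQ_apply,
      ← Submodule.Quotient.mk_smul, Submodule.Quotient.eq, ← Algebra.algebraMap_eq_smul_one]
    exact Submodule.subset_span (Or.inr (Or.inr rfl))
  d_smul := by
    rw [vacuum, ← map_smul, smul_eq_mul, mul_one, Submodule.mkQ_apply,
      Submodule.Quotient.mk_eq_zero]
    exact Submodule.subset_span (Or.inr (Or.inl rfl))

end Concrete

/-! ### Simply laced root systems and extremality of root vectors. -/

section Roots

open LieAlgebra LieAlgebra.IsKilling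

theorem induction_rootSpace {𝔤 : Type*} [LieRing 𝔤] [LieAlgebra ℂ 𝔤] [FiniteDimensional ℂ 𝔤]
    {𝔱 : LieSubalgebra ℂ 𝔤} [𝔱.IsCartanSubalgebra] {p : 𝔤 → Prop} (x : 𝔤) (h0 : p 0)
    (hadd : ∀ a b, p a → p b → p (a + b)) (h : ∀ (χ : 𝔱 → ℂ), ∀ x ∈ rootSpace 𝔱 χ, p x) : p x := by
  have hx : x ∈ (⨆ χ : LieModule.Weight ℂ 𝔱 𝔤, LieModule.genWeightSpace 𝔤 χ) := by
    rw [LieModule.iSup_genWeightSpace_eq_top']; trivial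
  induction hx using LieSubmodule.iSup_induction' with
  | mem χ x hx => exact h χ x hx
  | zero => exact h0
  | add a b _ _ ha hb => exact hadd a b ha hb

variable {𝔤 : Type*} [LieRing 𝔤] [LieAlgebra ℂ 𝔤] [FiniteDimensional ℂ 𝔤]
  [LieAlgebra.IsSimple ℂ 𝔤] {𝔱 : LieSubalgebra ℂ 𝔤} [𝔱.IsCartanSubalgebra]
  {B : LinearMap.BilinForm ℂ 𝔤}

theorem lie_rootSpace {χ : 𝔱 → ℂ} {x : 𝔤} (hx : x ∈ rootSpace 𝔱 χ) (h : 𝔱) :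
    ⁅(h : 𝔤), x⁆ = χ h • x :=
  lie_eq_smul_of_mem_rootSpace hx h

theorem form_eq_zero_of_add_ne_zero (hB : B.lieInvariant 𝔤) {χ ψ : 𝔱 → ℂ} {x y : 𝔤}
    (hx : x ∈ rootSpace 𝔱 χ) (hy : y ∈ rootSpace 𝔱 ψ) (h : χ + ψ ≠ 0) : B x y = 0 := by
  obtain ⟨t, ht⟩ := Function.ne_iff.1 h
  have := hB t x y
  rw [lie_rootSpace hx, lie_rootSpace hy] at this
  simp only [map_smul, LinearMap.smul_apply, smul_eq_mul] at this
  refine (mul_eq_zero.1 (?_ : (χ + ψ) t * B x y = 0)).resolve_left ht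
  rw [Pi.add_apply]
  linear_combination this

theorem exists_root_of_mem_rootSpace {χ : 𝔱 → ℂ} {x : 𝔤} (hx : x ∈ rootSpace 𝔱 χ) (hx0 : x ≠ 0)
    (hχ : χ ≠ 0) : ∃ γ : 𝔱.root, ∀ h, (rootSystem 𝔱).root γ h = χ h := by
  refine ⟨⟨⟨χ, fun h => hx0 (by simpa [h] using hx)⟩, ?_⟩, fun h => rfl⟩
  simpa [LieModule.Weight.IsNonZero, LieModule.Weight.IsZero] using hχ

theorem root_coroot (α β : 𝔱.root) : (rootSystem 𝔱).root α ((rootSystem 𝔱).coroot β) =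
    (((rootSystem 𝔱).pairingIn ℤ α β : ℤ) : ℂ) :=
  ((rootSystem 𝔱).algebraMap_pairingIn ℤ α β).symm

theorem exists_rootVectors (α : 𝔱.root) : ∃ e f : 𝔤, e ∈ rootSpace 𝔱 ((rootSystem 𝔱).root α) ∧
    f ∈ rootSpace 𝔱 (-((rootSystem 𝔱).root α : 𝔱 → ℂ)) ∧
    ⁅e, f⁆ = ((rootSystem 𝔱).coroot α : 𝔤) := by
  have hα := LieSubalgebra.isNonZero_coe_root α
  obtain ⟨h, e, f, hs, he, hf⟩ := exists_isSl2Triple_of_weight_isNonZero hα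
  exact ⟨e, f, he, hf, hs.lie_e_f.trans (hs.h_eq_coroot hα he hf)⟩

theorem form_coroot_aux (hB : B.lieInvariant 𝔤) {α : 𝔱.root} {e f : 𝔤}
    (hf : f ∈ rootSpace 𝔱 (-((rootSystem 𝔱).root α : 𝔱 → ℂ)))
    (hef : ⁅e, f⁆ = ((rootSystem 𝔱).coroot α : 𝔤)) (h : 𝔱) :
    B ((rootSystem 𝔱).coroot α : 𝔤) h = (rootSystem 𝔱).root α h * B e f := by
  have hf' : ⁅(h : 𝔤), f⁆ = -((rootSystem 𝔱).root α h) • f := lie_rootSpace hf h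
  rw [← hef, ← lie_skew e f, map_neg, LinearMap.neg_apply, hB f e h, ← lie_skew f (h : 𝔤), hf']
  simp [mul_comm]

/-- By invariance the coroot divided by `⟨e, f⟩` represents `α` under the form, so the normalization
reads `2 / ⟨e, f⟩ = 2`. -/
theorem form_rootVectors (hB : B.lieInvariant 𝔤) (hnd : B.Nondegenerate)
    (hnorm : IsNormalized B 𝔱) {α : 𝔱.root} {e f : 𝔤}
    (hf : f ∈ rootSpace 𝔱 (-((rootSystem 𝔱).root α : 𝔱 → ℂ)))
    (hef : ⁅e, f⁆ = ((rootSystem 𝔱).coroot α : 𝔤)) : B e f = 1 := by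
  have h2 : (rootSystem 𝔱).root α ((rootSystem 𝔱).coroot α) = 2 := (rootSystem 𝔱).root_coroot_two α
  -- Otherwise the coroot would be orthogonal to `𝔱`, hence, by weights, to all of `𝔤`, against
  -- nondegeneracy.
  have hne : B e f ≠ 0 := by
    intro h0
    have hall (x : 𝔤) : B ((rootSystem 𝔱).coroot α : 𝔤) x = 0 := by
      induction x using induction_rootSpace (𝔱 := 𝔱) with
      | h0 => exact map_zero _
      | hadd a b ha hb => rw [map_add, ha, hb, add_zero]
      | h χ x hx =>
        have hc : ((rootSystem 𝔱).coroot α : 𝔤) ∈ rootSpace 𝔱 (0 : 𝔱 → ℂ) := by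
          rw [LieAlgebra.rootSpace_zero_eq]
          exact Subtype.property _
        rcases eq_or_ne χ 0 with rfl | hχ
        · rw [LieAlgebra.rootSpace_zero_eq] at hx
          have := form_coroot_aux hB hf hef ⟨x, hx⟩
          rwa [h0, mul_zero] at this
        · exact form_eq_zero_of_add_ne_zero hB hc hx (by rwa [zero_add])
    have hz : ((rootSystem 𝔱).coroot α : 𝔤) = 0 := hnd.1 _ hall
    have hz' : (rootSystem 𝔱).coroot α = 0 := Subtype.ext hz
    rw [hz', map_zero] at h2
    exact two_ne_zero h2.symm
  have := hnorm α ((B e f)⁻¹ • (rootSystem 𝔱).coroot α) fun h => by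
    have := form_coroot_aux hB hf hef h
    change B ((B e f)⁻¹ • ((rootSystem 𝔱).coroot α : 𝔤)) h = _
    rw [map_smul, LinearMap.smul_apply, this, smul_eq_mul]
    field_simp
  rw [map_smul, h2, smul_eq_mul] at this
  field_simp at this
  exact this.symm

/-- The normalized form identifies the coroot of `α` with `α`. -/
theorem form_coroot (hB : B.lieInvariant 𝔤) (hnd : B.Nondegenerate)
    (hnorm : IsNormalized B 𝔱) (α : 𝔱.root) (h : 𝔱) :
    B ((rootSystem 𝔱).coroot α : 𝔤) h = (rootSystem 𝔱).root α h := by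
  obtain ⟨e, f, he, hf, hef⟩ := exists_rootVectors α
  rw [form_coroot_aux hB hf hef, form_rootVectors hB hnd hnorm hf hef, mul_one]

/-- This is where simple lacedness enters: Cartan integers become values of a symmetric form. -/
theorem pairing_symm (hB : B.lieInvariant 𝔤) (hs : B.IsSymm) (hnd : B.Nondegenerate)
    (hnorm : IsNormalized B 𝔱) (α β : 𝔱.root) :
    (rootSystem 𝔱).pairingIn ℤ α β = (rootSystem 𝔱).pairingIn ℤ β α := by
  have h1 := form_coroot hB hnd hnorm α ((rootSystem 𝔱).coroot β)
  have h2 := form_coroot hB hnd hnorm β ((rootSystem 𝔱).coroot α)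
  have h3 := hs.eq ((rootSystem 𝔱).coroot α : 𝔤) ((rootSystem 𝔱).coroot β : 𝔤)
  have h4 : (rootSystem 𝔱).pairing α β = (rootSystem 𝔱).pairing β α := by
    change (rootSystem 𝔱).root α ((rootSystem 𝔱).coroot β) =
      (rootSystem 𝔱).root β ((rootSystem 𝔱).coroot α)
    rw [← h1, ← h2]
    exact h3
  rw [← (rootSystem 𝔱).algebraMap_pairingIn ℤ, ← (rootSystem 𝔱).algebraMap_pairingIn ℤ] at h4
  exact_mod_cast h4

/-- For roots that are neither equal nor opposite, symmetric Cartan integers can only be `-1`, `0`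
or `1`. -/
theorem eq_of_two_le_pairing (hB : B.lieInvariant 𝔤) (hs : B.IsSymm) (hnd : B.Nondegenerate)
    (hnorm : IsNormalized B 𝔱) {α β : 𝔱.root} (h : 2 ≤ (rootSystem 𝔱).pairingIn ℤ α β) :
    α = β := by
  by_contra hne
  have hne1 : (rootSystem 𝔱).root α ≠ (rootSystem 𝔱).root β :=
    fun h => hne ((rootSystem 𝔱).root.injective h)
  have hne2 : (rootSystem 𝔱).root α ≠ -(rootSystem 𝔱).root β := by
    intro hn
    have h1 : (rootSystem 𝔱).root α ((rootSystem 𝔱).coroot β) = -2 := by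
      rw [hn, LinearMap.neg_apply]
      exact congrArg _ ((rootSystem 𝔱).root_coroot_two β)
    rw [root_coroot] at h1
    have h2 : (rootSystem 𝔱).pairingIn ℤ α β = -2 := by exact_mod_cast h1
    omega
  have := (rootSystem 𝔱).pairingIn_pairingIn_mem_set_of_isCrystal_of_isRed' α β hne1 hne2
  rw [pairing_symm hB hs hnd hnorm β α] at this
  simp only [Set.mem_insert_iff, Set.mem_singleton_iff, Prod.mk.injEq] at this
  omega

/-- A nonzero bracket would make `α + β` a root whose Cartan integer with `β` is at least `2`. It
would then equal `β`, forcing `α = 0`. -/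
theorem lie_eq_zero_of_pairing_nonneg (hB : B.lieInvariant 𝔤) (hs : B.IsSymm)
    (hnd : B.Nondegenerate) (hnorm : IsNormalized B 𝔱) {α β : 𝔱.root} {x y : 𝔤}
    (hx : x ∈ rootSpace 𝔱 ((rootSystem 𝔱).root α)) (hy : y ∈ rootSpace 𝔱 ((rootSystem 𝔱).root β))
    (h : 0 ≤ (rootSystem 𝔱).pairingIn ℤ α β) : ⁅x, y⁆ = 0 := by
  by_contra h0
  have hm := LieAlgebra.lie_mem_genWeightSpace_of_mem_genWeightSpace hx hy
  have h2 : (rootSystem 𝔱).root β ((rootSystem 𝔱).coroot β) = 2 := (rootSystem 𝔱).root_coroot_two β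
  obtain ⟨γ, hγ⟩ := exists_root_of_mem_rootSpace hm h0 (fun hz => by
    have := congrFun hz ((rootSystem 𝔱).coroot β)
    rw [Pi.add_apply, h2, root_coroot, Pi.zero_apply] at this
    norm_cast at this
    lia)
  have h3 := hγ ((rootSystem 𝔱).coroot β)
  rw [Pi.add_apply, h2, root_coroot, root_coroot] at h3
  norm_cast at h3
  obtain rfl := eq_of_two_le_pairing hB hs hnd hnorm (α := γ) (β := β) (by lia)
  refine (rootSystem 𝔱).ne_zero α (LinearMap.ext fun h => ?_)
  simpa using hγ h

theorem isExtremal_of_mem_rootSpace (hB : B.lieInvariant 𝔤) (hs : B.IsSymm)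
    (hnd : B.Nondegenerate) (hnorm : IsNormalized B 𝔱) {α : 𝔱.root} {e : 𝔤}
    (he : e ∈ rootSpace 𝔱 ((rootSystem 𝔱).root α)) : IsExtremal B e := by
  obtain ⟨e₀, f₀, he₀, hf₀, hef⟩ := exists_rootVectors α
  have hB1 := form_rootVectors hB hnd hnorm hf₀ hef
  have h2 : (rootSystem 𝔱).root α ((rootSystem 𝔱).coroot α) = 2 := (rootSystem 𝔱).root_coroot_two α
  have hne (χ : 𝔱 → ℂ) (h : χ ((rootSystem 𝔱).coroot α) ≠ 0) : χ ≠ 0 := by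
    rintro rfl
    exact h rfl
  have hα := LieSubalgebra.isNonZero_coe_root α
  have one_dim (χ : LieModule.Weight ℂ 𝔱 𝔤) (hχ : χ.IsNonZero) {x y : 𝔤}
      (hx : x ∈ rootSpace 𝔱 χ) (hx0 : x ≠ 0) (hy : y ∈ rootSpace 𝔱 χ) : ∃ c : ℂ, c • x = y := by
    obtain ⟨c, hc⟩ := (finrank_eq_one_iff_of_nonzero' (⟨x, hx⟩ : rootSpace 𝔱 χ)
      (fun h => hx0 (congrArg Subtype.val h))).1 (finrank_rootSpace_eq_one χ hχ) ⟨y, hy⟩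
    exact ⟨c, congrArg Subtype.val hc⟩
  refine ⟨form_eq_zero_of_add_ne_zero hB he he (hne _ (by rw [Pi.add_apply, h2]; norm_num)), fun x => ?_⟩
  induction x using induction_rootSpace (𝔱 := 𝔱) with
  | h0 => simp
  | hadd a b ha hb => rw [lie_add, lie_add, ha, hb, map_add, mul_add, add_smul]
  | h χ x hx =>
    rcases eq_or_ne χ (-((rootSystem 𝔱).root α : 𝔱 → ℂ)) with rfl | hχ
    · obtain ⟨s, rfl⟩ := one_dim α.1 hα he₀ (by rintro rfl; simp at hB1) he
      obtain ⟨t, rfl⟩ := one_dim (-α.1) hα.neg hf₀ (by rintro rfl; simp at hB1) hx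
      have h3 : ⁅((rootSystem 𝔱).coroot α : 𝔤), e₀⁆ = (2 : ℂ) • e₀ := by
        rw [lie_rootSpace he₀, h2]
      simp only [smul_lie, lie_smul, hef, map_smul, LinearMap.smul_apply, hB1, smul_eq_mul]
      rw [← lie_skew, h3]
      module
    -- Away from weight `-α` both sides vanish. In weight `0`, `[e, x]` is a multiple of `e`. If `α
    -- + β` is a root, its Cartan integer with `α` is `2 + ⟨β, α⟩ ≥ 0`, so `e` commutes with `[e,
    -- x]`.
    · have hz : (((rootSystem 𝔱).root α : 𝔱 → ℂ)) + χ ≠ 0 := fun h =>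
        hχ (eq_neg_of_add_eq_zero_right h)
      rw [form_eq_zero_of_add_ne_zero hB he hx hz, mul_zero, zero_smul]
      by_contra h0
      rcases eq_or_ne χ 0 with rfl | hχ0
      · rw [rootSpace_zero_eq] at hx
        have : ⁅x, e⁆ = (rootSystem 𝔱).root α ⟨x, hx⟩ • e := lie_rootSpace he ⟨x, hx⟩
        rw [← lie_skew e x, this] at h0
        simp at h0
      · have hx0 : x ≠ 0 := by rintro rfl; simp at h0
        obtain ⟨β, hβ⟩ := exists_root_of_mem_rootSpace hx hx0 hχ0
        obtain rfl : χ = (rootSystem 𝔱).root β := funext fun h => (hβ h).symm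
        have h1 : ⁅e, x⁆ ≠ 0 := fun h1 => h0 (by rw [h1, lie_zero])
        obtain ⟨γ, hγ⟩ := exists_root_of_mem_rootSpace
          (LieAlgebra.lie_mem_genWeightSpace_of_mem_genWeightSpace he hx) h1 hz
        refine h0 (lie_eq_zero_of_pairing_nonneg hB hs hnd hnorm (α := α) (β := γ) he ?_ ?_)
        · rw [show ((rootSystem 𝔱).root γ : 𝔱 → ℂ) = _ from funext hγ]
          exact LieAlgebra.lie_mem_genWeightSpace_of_mem_genWeightSpace he hx
        · have h3 := hγ ((rootSystem 𝔱).coroot α)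
          rw [Pi.add_apply, h2, root_coroot, root_coroot] at h3
          norm_cast at h3
          have h4 := (rootSystem 𝔱).pairingIn_pairingIn_mem_set_of_isCrystal_of_isRed α β
          rw [pairing_symm hB hs hnd hnorm α β] at h4
          simp only [Set.mem_insert_iff, Set.mem_singleton_iff, Prod.mk.injEq] at h4
          rw [pairing_symm hB hs hnd hnorm α γ]
          omega

end Roots

/-! ### Roots in coordinates and the Cartan matrix as Gram matrix. -/

open LieAlgebra LieAlgebra.IsKilling Matrix

/-- The integral form on the root lattice with the Cartan matrix as Gram matrix. -/
def TwistedType.pair (X : TwistedType) (γ δ : X.Lattice) : ℤ := γ ⬝ᵥ (X.cartan *ᵥ δ)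

namespace TwistedDatum

variable {𝔤 : Type*} [LieRing 𝔤] [LieAlgebra ℂ 𝔤] [FiniteDimensional ℂ 𝔤]
  [LieAlgebra.IsSimple ℂ 𝔤] {𝔱 : LieSubalgebra ℂ 𝔤} [𝔱.IsCartanSubalgebra]
  {X : TwistedType} (T : TwistedDatum X 𝔱)

/-- `γ` is the coordinate vector of a root. -/
def IsRoot (γ : X.Lattice) : Prop :=
  ∃ α : 𝔱.root, (rootSystem 𝔱).root α = rootCombination T.enum γ

theorem rootCombination_apply_coroot {γ : X.Lattice} (β : 𝔱.root) :
    rootCombination T.enum γ ((rootSystem 𝔱).coroot β) =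
      ((∑ p, γ p * (rootSystem 𝔱).pairingIn ℤ (T.enum p) β : ℤ) : ℂ) := by
  rw [rootCombination, LinearMap.sum_apply, Int.cast_sum]
  refine Finset.sum_congr rfl fun p _ => ?_
  rw [LinearMap.smul_apply, root_coroot, zsmul_eq_mul, Int.cast_mul]

theorem pairingIn_eq_sum {γ : X.Lattice} {α : 𝔱.root}
    (hα : (rootSystem 𝔱).root α = rootCombination T.enum γ) (β : 𝔱.root) :
    (rootSystem 𝔱).pairingIn ℤ α β = ∑ p, γ p * (rootSystem 𝔱).pairingIn ℤ (T.enum p) β := by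
  have := T.rootCombination_apply_coroot (γ := γ) β
  rw [← hα, root_coroot] at this
  exact_mod_cast this

theorem pairingIn_enum {γ : X.Lattice} {α : 𝔱.root}
    (hα : (rootSystem 𝔱).root α = rootCombination T.enum γ) (q : Fin X.rank) :
    (rootSystem 𝔱).pairingIn ℤ α (T.enum q) = ∑ p, γ p * X.cartan p q := by
  rw [T.pairingIn_eq_sum hα]
  exact Finset.sum_congr rfl fun p _ => by rw [← T.cartan_eq]; rfl

theorem rootCombination_single (p : Fin X.rank) (m : ℤ) :
    rootCombination T.enum (Pi.single p m) = m • (rootSystem 𝔱).root (T.enum p) := by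
  rw [rootCombination, Finset.sum_eq_single p]
  · rw [Pi.single_eq_same]
  · intro q _ hq
    rw [Pi.single_eq_of_ne hq, zero_smul]
  · simp

theorem rootCombination_add (γ δ : X.Lattice) : rootCombination T.enum (γ + δ) =
    rootCombination T.enum γ + rootCombination T.enum δ := by
  simp only [rootCombination, Pi.add_apply, add_smul, Finset.sum_add_distrib]

theorem rootCombination_neg (γ : X.Lattice) : rootCombination T.enum (-γ) =
    -rootCombination T.enum γ := by
  simp only [rootCombination, Pi.neg_apply, neg_smul, Finset.sum_neg_distrib]

variable {T}

theorem isRoot_single (p : Fin X.rank) : T.IsRoot (Pi.single p 1) :=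
  ⟨T.enum p, by rw [T.rootCombination_single, one_smul]⟩

theorem IsRoot.neg {γ : X.Lattice} (h : T.IsRoot γ) : T.IsRoot (-γ) := by
  obtain ⟨α, hα⟩ := h
  refine ⟨(rootSystem 𝔱).reflectionPerm α α, ?_⟩
  rw [T.rootCombination_neg, ← hα, RootPairing.root_reflectionPerm, RootPairing.reflection_apply_self]

/-- The reflection of a root in a simple root is a root. -/
theorem IsRoot.add_single {γ : X.Lattice} (h : T.IsRoot γ) (q : Fin X.rank) {m : ℤ}
    (hm : ∑ p, γ p * X.cartan p q = -m) : T.IsRoot (γ + Pi.single q m) := by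
  obtain ⟨α, hα⟩ := h
  refine ⟨(rootSystem 𝔱).reflectionPerm (T.enum q) α, ?_⟩
  rw [T.rootCombination_add, T.rootCombination_single, ← hα, RootPairing.root_reflectionPerm,
    RootPairing.reflection_apply_root, ← (rootSystem 𝔱).algebraMap_pairingIn ℤ,
    T.pairingIn_enum hα, hm, sub_eq_add_neg]
  simp [Int.cast_smul_eq_zsmul]

variable {B : LinearMap.BilinForm ℂ 𝔤} (hB : B.lieInvariant 𝔤) (hs : B.IsSymm)
  (hnd : B.Nondegenerate) (hnorm : IsNormalized B 𝔱)

include hB hs hnd hnorm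

/-- Cartan integers are additive in the first root only. Symmetry supplies the expansion in the
second, and inner products of roots become integer computations. -/
theorem pairingIn_eq_pair {γ δ : X.Lattice} {α β : 𝔱.root}
    (hα : (rootSystem 𝔱).root α = rootCombination T.enum γ)
    (hβ : (rootSystem 𝔱).root β = rootCombination T.enum δ) :
    (rootSystem 𝔱).pairingIn ℤ α β = X.pair γ δ := by
  rw [T.pairingIn_eq_sum hα, TwistedType.pair, dotProduct]
  refine Finset.sum_congr rfl fun p _ => ?_
  rw [pairing_symm hB hs hnd hnorm, T.pairingIn_eq_sum hβ, mulVec, dotProduct]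
  congr 1
  refine Finset.sum_congr rfl fun q _ => ?_
  rw [← T.cartan_eq, mul_comm, pairing_symm hB hs hnd hnorm]
  rfl

theorem IsRoot.pair_self {γ : X.Lattice} (h : T.IsRoot γ) : X.pair γ γ = 2 := by
  obtain ⟨α, hα⟩ := h
  rw [← pairingIn_eq_pair hB hs hnd hnorm hα hα, RootPairing.pairingIn_same]

theorem pair_comm (T : TwistedDatum X 𝔱) (γ δ : X.Lattice) : X.pair γ δ = X.pair δ γ := by
  have h : X.cartanᵀ = X.cartan := by
    ext i j
    rw [transpose_apply, ← T.cartan_eq, ← T.cartan_eq]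
    exact pairing_symm hB hs hnd hnorm _ _
  rw [TwistedType.pair, TwistedType.pair, dotProduct_mulVec, dotProduct_comm, ← mulVec_transpose, h]

/-- If `γ - δ = a - b` for roots `γ, δ, a, b`, then `⟨γ, δ⟩ = ⟨a, b⟩`. -/
theorem IsRoot.pair_eq_pair {γ δ a b : X.Lattice} (hγ : T.IsRoot γ) (hδ : T.IsRoot δ)
    (ha : T.IsRoot a) (hb : T.IsRoot b) (h : γ - δ = a - b) : X.pair γ δ = X.pair a b := by
  -- All roots have norm `2`, so the norm of a difference determines the inner product.
  have expand (u v : X.Lattice) (hu : T.IsRoot u) (hv : T.IsRoot v) :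
      X.pair (u - v) (u - v) = 4 - 2 * X.pair u v := by
    have h1 : X.pair (u - v) (u - v) = X.pair u u - X.pair u v - (X.pair v u - X.pair v v) := by
      simp only [TwistedType.pair, mulVec_sub, sub_dotProduct, dotProduct_sub]
      ring
    rw [h1, hu.pair_self hB hs hnd hnorm, hv.pair_self hB hs hnd hnorm,
      pair_comm hB hs hnd hnorm T v u]
    ring
  have h1 := expand γ δ hγ hδ
  rw [h, expand a b ha hb] at h1
  omega

theorem IsRoot.lie_eq_zero {γ δ : X.Lattice} (hγ : T.IsRoot γ) (hδ : T.IsRoot δ)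
    (h : 0 ≤ X.pair γ δ) : ⁅T.rootVec γ, T.rootVec δ⁆ = 0 := by
  obtain ⟨α, hα⟩ := hγ
  obtain ⟨β, hβ⟩ := hδ
  refine lie_eq_zero_of_pairing_nonneg hB hs hnd hnorm (T.rootVec_mem γ α hα)
    (T.rootVec_mem δ β hβ) ?_
  rwa [pairingIn_eq_pair hB hs hnd hnorm hα hβ]

theorem IsRoot.isExtremal {γ : X.Lattice} (hγ : T.IsRoot γ) : IsExtremal B (T.rootVec γ) := by
  obtain ⟨α, hα⟩ := hγ
  exact isExtremal_of_mem_rootSpace hB hs hnd hnorm (T.rootVec_mem γ α hα)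

end TwistedDatum

/-! ### The calculus of multipliers `t`. -/

section Annihilates

variable {𝔤 : Type*} [LieRing 𝔤] [LieAlgebra ℂ 𝔤] (B : LinearMap.BilinForm ℂ 𝔤)
  (hB : B.lieInvariant 𝔤) (hs : B.IsSymm)

/-- `x(-1)ⁿ 𝟏` lies in the maximal submodule for all `n > t k`. -/
def AnnihilatesVacuum (k t : ℕ) (x : 𝔤) : Prop :=
  ∀ n ≥ t * k + 1, powVacuum B hB hs k x n ∈ maximalSubmodule B hB hs k

variable {B hB hs} {k t u : ℕ} {x y : 𝔤}

theorem IsExtremal.annihilatesVacuum (hx : IsExtremal B x) : AnnihilatesVacuum B hB hs k 1 x :=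
  fun _ hn => (isVacuum_vacuum B hB hs k).pow_smul_mem hB hs hx (by lia)

theorem AnnihilatesVacuum.smul (hx : AnnihilatesVacuum B hB hs k t x) (s : ℂ) :
    AnnihilatesVacuum B hB hs k t (s • x) := fun n hn => by
  have := pow_smul_mem_of_smul _ s (hx n hn)
  change (envGenerators B hB hs).X (-1) (s • x) ^ n • _ ∈ _
  rwa [map_smul]

/-- Multipliers add because `(t + u)k + 1 = tk + uk + 1` is exactly the binomial threshold. -/
theorem AnnihilatesVacuum.add (hx : AnnihilatesVacuum B hB hs k t x)
    (hy : AnnihilatesVacuum B hB hs k u y) (hxy : ⁅x, y⁆ = 0) :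
    AnnihilatesVacuum B hB hs k (t + u) (x + y) := fun n hn => by
  change (envGenerators B hB hs).X (-1) (x + y) ^ n • _ ∈ _
  rw [map_add]
  exact add_pow_smul_mem _ (AffineGenerators.commute_X hxy (by lia)) hx hy (by linarith)

theorem AnnihilatesVacuum.sub (hx : AnnihilatesVacuum B hB hs k t x)
    (hy : AnnihilatesVacuum B hB hs k u y) (hxy : ⁅x, y⁆ = 0) :
    AnnihilatesVacuum B hB hs k (t + u) (x - y) := by
  have := hx.add (hy.smul (-1)) (by rw [lie_smul, hxy, smul_zero])
  rwa [neg_one_smul, ← sub_eq_add_neg] at this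

end Annihilates

namespace TwistedType

variable (X : TwistedType)

theorem pair_neg_neg (γ δ : X.Lattice) : X.pair (-γ) (-δ) = X.pair γ δ := by
  simp [pair, mulVec_neg]

theorem pair_neg_right (γ δ : X.Lattice) : X.pair γ (-δ) = -X.pair γ δ := by
  simp [pair, mulVec_neg]

theorem simple_eq_single {j : ℕ} (p : Fin X.rank) (h : (p : ℕ) + 1 = j) :
    X.simple j = Pi.single p 1 := by
  funext q
  simp only [simple, Pi.single_apply, Fin.ext_iff]
  split_ifs <;> first | rfl | lia

theorem pair_simple {i j : ℕ} (p q : Fin X.rank) (hp : (p : ℕ) + 1 = i) (hq : (q : ℕ) + 1 = j) :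
    X.pair (X.simple i) (X.simple j) = X.cartan p q := by
  rw [X.simple_eq_single p hp, X.simple_eq_single q hq, pair, mulVec_single_one,
    single_one_dotProduct]
  rfl

end TwistedType

namespace TwistedDatum

variable {𝔤 : Type*} [LieRing 𝔤] [LieAlgebra ℂ 𝔤] [FiniteDimensional ℂ 𝔤]
  [LieAlgebra.IsSimple ℂ 𝔤] {𝔱 : LieSubalgebra ℂ 𝔤} [𝔱.IsCartanSubalgebra]
  {X : TwistedType} {T : TwistedDatum X 𝔱}

theorem isRoot_simple {j : ℕ} (hj : 1 ≤ j) (hj' : j ≤ X.rank) : T.IsRoot (X.simple j) := by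
  rw [X.simple_eq_single ⟨j - 1, by lia⟩ (by simp; lia)]
  exact isRoot_single _

variable {B : LinearMap.BilinForm ℂ 𝔤}

theorem IsRoot.form_neg (hB : B.lieInvariant 𝔤) (hnd : B.Nondegenerate)
    (hnorm : IsNormalized B 𝔱) {γ : X.Lattice} (hγ : T.IsRoot γ) :
    B (T.rootVec γ) (T.rootVec (-γ)) = 1 := by
  obtain ⟨β, hβ⟩ := hγ.neg
  obtain ⟨α, hα⟩ := hγ
  have h := T.rootVec_mem (-γ) β hβ
  rw [hβ, T.rootCombination_neg, ← hα] at h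
  exact form_rootVectors hB hnd hnorm h (T.lie_rootVec γ α hα)

variable (hB : B.lieInvariant 𝔤) (hs : B.IsSymm)
  (hnd : B.Nondegenerate) (hnorm : IsNormalized B 𝔱)

include hB hs hnd hnorm

theorem IsRoot.annihilatesVacuum {γ : X.Lattice} (hγ : T.IsRoot γ) (k : ℕ) :
    AnnihilatesVacuum B hB hs k 1 (T.rootVec γ) :=
  (hγ.isExtremal hB hs hnd hnorm).annihilatesVacuum

theorem IsRoot.form_eq_zero {γ δ : X.Lattice} (hγ : T.IsRoot γ) (hδ : T.IsRoot δ)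
    (h : X.pair γ δ ≠ -2) : B (T.rootVec γ) (T.rootVec δ) = 0 := by
  obtain ⟨α, hα⟩ := hγ
  obtain ⟨β, hβ⟩ := hδ
  refine form_eq_zero_of_add_ne_zero hB (T.rootVec_mem γ α hα) (T.rootVec_mem δ β hβ) fun h0 => h ?_
  have h1 := congrFun h0 ((rootSystem 𝔱).coroot β)
  rw [Pi.add_apply, root_coroot, root_coroot, RootPairing.pairingIn_same,
    pairingIn_eq_pair hB hs hnd hnorm hα hβ, Pi.zero_apply] at h1
  have h2 : X.pair γ δ + 2 = 0 := by exact_mod_cast h1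
  lia

theorem IsRoot.lie_lie_neg {γ δ : X.Lattice} (hγ : T.IsRoot γ) (hδ : T.IsRoot δ) :
    ⁅⁅T.rootVec γ, T.rootVec (-γ)⁆, T.rootVec δ⁆ = (X.pair δ γ : ℂ) • T.rootVec δ := by
  obtain ⟨α, hα⟩ := hγ
  obtain ⟨β, hβ⟩ := hδ
  rw [T.lie_rootVec γ α hα, lie_rootSpace (T.rootVec_mem δ β hβ), root_coroot,
    pairingIn_eq_pair hB hs hnd hnorm hβ hα]

theorem IsRoot.add_annihilatesVacuum {γ δ : X.Lattice} (hγ : T.IsRoot γ) (hδ : T.IsRoot δ)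
    (h : X.pair γ δ = 0) (k : ℕ) :
    AnnihilatesVacuum B hB hs k 2 (T.rootVec γ + T.rootVec δ) :=
  (hγ.annihilatesVacuum hB hs hnd hnorm k).add (hδ.annihilatesVacuum hB hs hnd hnorm k)
    (hγ.lie_eq_zero hB hs hnd hnorm hδ h.ge)

theorem IsRoot.sub_annihilatesVacuum {γ δ : X.Lattice} (hγ : T.IsRoot γ) (hδ : T.IsRoot δ)
    (h : X.pair γ δ = 0) (k : ℕ) :
    AnnihilatesVacuum B hB hs k 2 (T.rootVec γ - T.rootVec δ) :=
  (hγ.annihilatesVacuum hB hs hnd hnorm k).sub (hδ.annihilatesVacuum hB hs hnd hnorm k)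
    (hγ.lie_eq_zero hB hs hnd hnorm hδ h.ge)

/-- The principal nilpotent element of the copy of `sl₃` attached to two roots at angle `2π/3`. -/
theorem IsRoot.principal_annihilatesVacuum {γ δ : X.Lattice} (hγ : T.IsRoot γ) (hδ : T.IsRoot δ)
    (h : X.pair γ δ = -1) {s : ℂ} (hs2 : s * s = 2) (k : ℕ) :
    AnnihilatesVacuum B hB hs k 4 (s • (T.rootVec (-γ) + T.rootVec (-δ))) := by
  have h' : X.pair δ γ = -1 := by rw [pair_comm hB hs hnd hnorm T, h]
  have hγγ := hγ.pair_self hB hs hnd hnorm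
  have hδδ := hδ.pair_self hB hs hnd hnorm
  -- Some power must be known to land in the maximal submodule before `sl₂`-theory can lower the
  -- exponent.
  have hnil := (isVacuum_vacuum B hB hs k).extremal_add_nilpotent hB hs
    (hγ.neg.isExtremal hB hs hnd hnorm) (hδ.neg.isExtremal hB hs hnd hnorm)
    (hγ.neg.form_eq_zero hB hs hnd hnorm hδ.neg (by rw [X.pair_neg_neg, h]; decide))
  have hnil' := pow_smul_mem_of_smul _ s hnil
  rw [← map_smul] at hnil'
  have e1 : ⁅T.rootVec γ, T.rootVec (-δ)⁆ = 0 :=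
    hγ.lie_eq_zero hB hs hnd hnorm hδ.neg (by rw [X.pair_neg_right, h]; decide)
  have e2 : ⁅T.rootVec δ, T.rootVec (-γ)⁆ = 0 :=
    hδ.lie_eq_zero hB hs hnd hnorm hγ.neg (by rw [X.pair_neg_right, h']; decide)
  have pneg (a b : X.Lattice) : X.pair (-a) b = -X.pair a b := by
    rw [← X.pair_neg_neg, neg_neg, X.pair_neg_right]
  intro n hn
  -- The raising element is `s(x_γ + x_δ)`. Mixed brackets vanish, so `h = s²(h_γ + h_δ)` acts on
  -- each summand of `f` by `s²(-2 + 1) = -2`, which fixes `s² = 2`. The multiplier is `⟨e, f⟩ = 2s²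
  -- = 4`.
  refine pow_smul_mem_of_le _ hn ((isVacuum_vacuum B hB hs k).sl2_pow_smul_mem _
    (e := s • (T.rootVec γ + T.rootVec δ)) rfl ?_ ?_ hnil')
  · simp only [smul_lie, lie_smul, add_lie, lie_add, e1, e2,
      hγ.lie_lie_neg hB hs hnd hnorm hγ.neg, hγ.lie_lie_neg hB hs hnd hnorm hδ.neg,
      hδ.lie_lie_neg hB hs hnd hnorm hγ.neg, hδ.lie_lie_neg hB hs hnd hnorm hδ.neg, pneg,
      h, h', hγγ, hδδ, zero_lie, smul_add, smul_smul]
    match_scalars <;> linear_combination -s * hs2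
  · simp only [map_smul, LinearMap.smul_apply, map_add, LinearMap.add_apply,
      hγ.form_neg hB hnd hnorm, hδ.form_neg hB hnd hnorm,
      hγ.form_eq_zero hB hs hnd hnorm hδ.neg (by rw [X.pair_neg_right, h]; decide),
      hδ.form_eq_zero hB hs hnd hnorm hγ.neg (by rw [X.pair_neg_right, h']; decide), smul_eq_mul]
    push_cast
    linear_combination 2 * hs2

end TwistedDatum

/-! ### Roots supported on chains of the Dynkin diagram. -/

/-- The vector `α₁ + ⋯ + α_j`. -/
def TwistedType.partialSum (X : TwistedType) (j : ℕ) : X.Lattice :=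
  fun p => if (p : ℕ) < j then 1 else 0

theorem TwistedType.partialSum_succ (X : TwistedType) {j : ℕ} (hj : j < X.rank) :
    X.partialSum (j + 1) = X.partialSum j + Pi.single ⟨j, hj⟩ 1 := by
  funext p
  simp only [partialSum, Pi.add_apply, Pi.single_apply, Fin.ext_iff]
  split_ifs <;> first | rfl | lia

/-- Along a chain, a node beyond the first `j + 1` meets at most the last of them. The bound `N`
allows the chain to stop before the branch node of type `D`. -/
theorem TwistedType.sum_partialSum_mul (X : TwistedType) {N : ℕ} (hN : N ≤ X.rank)
    (h1 : ∀ p q : Fin X.rank, (q : ℕ) < N → (p : ℕ) + 1 = q → X.cartan p q = -1)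
    (h0 : ∀ p q : Fin X.rank, (q : ℕ) < N → (p : ℕ) + 2 ≤ q → X.cartan p q = 0) (j : ℕ) :
    ∀ q : Fin X.rank, (q : ℕ) < N → j + 1 ≤ q →
      ∑ p, X.partialSum (j + 1) p * X.cartan p q = if (q : ℕ) = j + 1 then -1 else 0 := by
  have step (j : ℕ) (hj : j < X.rank) (q : Fin X.rank) :
      ∑ p, X.partialSum (j + 1) p * X.cartan p q =
        ∑ p, X.partialSum j p * X.cartan p q + X.cartan ⟨j, hj⟩ q := by
    rw [X.partialSum_succ hj]
    simp [add_mul, Finset.sum_add_distrib, Pi.single_apply]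
  have last (j : ℕ) (hj : j < X.rank) (q : Fin X.rank) (hq : (q : ℕ) < N) (hjq : j + 1 ≤ q) :
      X.cartan ⟨j, hj⟩ q = if (q : ℕ) = j + 1 then -1 else 0 := by
    split_ifs with h
    · exact h1 _ _ hq h.symm
    · exact h0 _ _ hq (by simp only; lia)
  induction j with
  | zero =>
    intro q hq hjq
    rw [step 0 (by lia), last 0 (by lia) q hq hjq]
    simp [partialSum]
  | succ j ih =>
    intro q hq hjq
    rw [step (j + 1) (by lia), last (j + 1) (by lia) q hq hjq, ih q hq (by lia), if_neg (by lia),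
      zero_add]

namespace TwistedDatum

variable {𝔤 : Type*} [LieRing 𝔤] [LieAlgebra ℂ 𝔤] [FiniteDimensional ℂ 𝔤]
  [LieAlgebra.IsSimple ℂ 𝔤] {𝔱 : LieSubalgebra ℂ 𝔤} [𝔱.IsCartanSubalgebra]
  {X : TwistedType} {T : TwistedDatum X 𝔱}

theorem IsRoot.step {γ δ : X.Lattice} (h : T.IsRoot γ) (q : Fin X.rank) {m : ℤ}
    (hm : ∑ p, γ p * X.cartan p q = -m) (hδ : ∀ p, δ p = γ p + if p = q then m else 0) :
    T.IsRoot δ := by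
  rw [show δ = γ + Pi.single q m from
    funext fun p => by rw [hδ, Pi.add_apply, Pi.single_apply]]
  exact h.add_single q hm

/-- The reflection in the next node of the chain adds it, since the Cartan integer there is `-1`. -/
theorem isRoot_partialSum {N : ℕ} (hN : N ≤ X.rank)
    (h1 : ∀ p q : Fin X.rank, (q : ℕ) < N → (p : ℕ) + 1 = q → X.cartan p q = -1)
    (h0 : ∀ p q : Fin X.rank, (q : ℕ) < N → (p : ℕ) + 2 ≤ q → X.cartan p q = 0) {j : ℕ}
    (hj : j + 1 ≤ N) : T.IsRoot (X.partialSum (j + 1)) := by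
  induction j with
  | zero =>
    have := isRoot_single (T := T) ⟨0, by lia⟩
    rwa [show X.partialSum (0 + 1) = _ from (X.partialSum_succ (by lia)).trans
      (by rw [show X.partialSum 0 = 0 by funext p; simp [TwistedType.partialSum], zero_add])]
  | succ j ih =>
    refine (ih (by lia)).step ⟨j + 1, by lia⟩ ?_ fun p => by
      rw [X.partialSum_succ (by lia), Pi.add_apply, Pi.single_apply]
    rw [X.sum_partialSum_mul hN h1 h0 j _ (by simp only; lia) le_rfl, if_pos rfl]

variable {B : LinearMap.BilinForm ℂ 𝔤} (hB : B.lieInvariant 𝔤) (hs : B.IsSymm)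
  (hnd : B.Nondegenerate) (hnorm : IsNormalized B 𝔱)

include hB hs hnd hnorm

theorem annihilatesVacuum_simple {i : ℕ} (p : Fin X.rank) (hp : (p : ℕ) + 1 = i) (k : ℕ) :
    AnnihilatesVacuum B hB hs k 1 (T.rootVec (-X.simple i)) :=
  (isRoot_simple (by lia) (by lia)).neg.annihilatesVacuum hB hs hnd hnorm k

theorem annihilatesVacuum_simple_add_simple {i j : ℕ} (p q : Fin X.rank) (hp : (p : ℕ) + 1 = i)
    (hq : (q : ℕ) + 1 = j) (h : X.cartan p q = 0) (k : ℕ) :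
    AnnihilatesVacuum B hB hs k 2 (T.rootVec (-X.simple i) + T.rootVec (-X.simple j)) :=
  (isRoot_simple (by lia) (by lia)).neg.add_annihilatesVacuum hB hs hnd hnorm
    (isRoot_simple (by lia) (by lia)).neg (by rw [X.pair_neg_neg, X.pair_simple p q hp hq, h]) k

/-- If `γ - δ = α_i - α_j` with `α_i ⟂ α_j`, then `x_γ` and `x_δ` commute. -/
theorem IsRoot.sub_annihilatesVacuum_of_sub_eq {γ δ : X.Lattice} (hγ : T.IsRoot γ)
    (hδ : T.IsRoot δ) {i j : ℕ} (p q : Fin X.rank) (hp : (p : ℕ) + 1 = i)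
    (hq : (q : ℕ) + 1 = j) (h : X.cartan p q = 0)
    (hsub : γ - δ = X.simple i - X.simple j) (k : ℕ) :
    AnnihilatesVacuum B hB hs k 2 (T.rootVec γ - T.rootVec δ) :=
  hγ.sub_annihilatesVacuum hB hs hnd hnorm hδ (by
    rw [hγ.pair_eq_pair hB hs hnd hnorm hδ (isRoot_simple (by lia) (by lia))
      (isRoot_simple (by lia) (by lia)) hsub, X.pair_simple p q hp hq, h]) k

end TwistedDatum

/-! ### Verification in the five types. -/

namespace TwistedType

theorem cartan_Aeven (l : ℕ) (hl : 1 ≤ l) (p q : Fin (Aeven l hl).rank) :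
    (Aeven l hl).cartan p q = if (p : ℕ) = q then 2 else
      if (p : ℕ) + 1 = q ∨ (q : ℕ) + 1 = p then -1 else 0 := by
  simp only [← Fin.ext_iff]
  rfl

theorem cartan_Aodd (l : ℕ) (hl : 2 ≤ l) (p q : Fin (Aodd l hl).rank) :
    (Aodd l hl).cartan p q = if (p : ℕ) = q then 2 else
      if (p : ℕ) + 1 = q ∨ (q : ℕ) + 1 = p then -1 else 0 := by
  simp only [← Fin.ext_iff]
  rfl

theorem cartan_D (l : ℕ) (hl : 2 ≤ l) (p q : Fin (D l hl).rank) :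
    (D l hl).cartan p q = if (p : ℕ) = q then 2 else
      if ((p : ℕ) + 1 = q ∧ (q : ℕ) < l) ∨ ((q : ℕ) + 1 = p ∧ (p : ℕ) < l) ∨
        ((p : ℕ) + 2 = l ∧ (q : ℕ) = l) ∨ ((q : ℕ) + 2 = l ∧ (p : ℕ) = l) then -1 else 0 := by
  have key (p q : Fin (l + 1)) : CartanMatrix.D (l + 1) p q = if (p : ℕ) = q then 2 else
      if ((p : ℕ) + 1 = q ∧ (q : ℕ) < l) ∨ ((q : ℕ) + 1 = p ∧ (p : ℕ) < l) ∨
        ((p : ℕ) + 2 = l ∧ (q : ℕ) = l) ∨ ((q : ℕ) + 2 = l ∧ (p : ℕ) = l) then -1 else 0 := by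
    have hp : (p : ℕ) < l + 1 := p.2
    have hq : (q : ℕ) < l + 1 := q.2
    simp only [CartanMatrix.D, Matrix.of_apply, Fin.ext_iff]
    split_ifs <;> first | rfl | lia
  exact key p q

end TwistedType

namespace TwistedDatum

variable {𝔤 : Type*} [LieRing 𝔤] [LieAlgebra ℂ 𝔤] [FiniteDimensional ℂ 𝔤]
  [LieAlgebra.IsSimple ℂ 𝔤] {𝔱 : LieSubalgebra ℂ 𝔤} [𝔱.IsCartanSubalgebra]
  {B : LinearMap.BilinForm ℂ 𝔤} (hB : B.lieInvariant 𝔤) (hs : B.IsSymm)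
  (hnd : B.Nondegenerate) (hnorm : IsNormalized B 𝔱)

include hB hs hnd hnorm

theorem annihilatesVacuum_Aeven {l : ℕ} {hl : 1 ≤ l} (T : TwistedDatum (.Aeven l hl) 𝔱) (i k : ℕ) :
    AnnihilatesVacuum B hB hs k (if i = 0 then 1 else if i < l then 2 else 4) (T.F i) := by
  simp only [TwistedDatum.F, TwistedType.F]
  have hr : (TwistedType.Aeven l hl).rank = 2 * l := rfl
  have h1 (p q : Fin (TwistedType.Aeven l hl).rank) (_ : (q : ℕ) < 2 * l) (h : (p : ℕ) + 1 = q) :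
      (TwistedType.Aeven l hl).cartan p q = -1 := by
    rw [TwistedType.cartan_Aeven, if_neg (by lia), if_pos (by lia)]
  have h0 (p q : Fin (TwistedType.Aeven l hl).rank) (_ : (q : ℕ) < 2 * l) (h : (p : ℕ) + 2 ≤ q) :
      (TwistedType.Aeven l hl).cartan p q = 0 := by
    rw [TwistedType.cartan_Aeven, if_neg (by lia), if_neg (by lia)]
  split_ifs with hi0 hil
  · refine IsRoot.annihilatesVacuum hB hs hnd hnorm ?_ k
    convert isRoot_partialSum (T := T) hr.ge h1 h0 (j := 2 * l - 1) (by lia) using 1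
    funext p
    change (1 : ℤ) = if (p : ℕ) < 2 * l - 1 + 1 then 1 else 0
    rw [if_pos (by have := p.2; lia)]
  · exact annihilatesVacuum_simple_add_simple hB hs hnd hnorm ⟨i - 1, by lia⟩
      ⟨2 * l - i, by lia⟩ (by simp only; lia) (by simp only) (h0 _ _ (by simp only; lia)
      (by simp only; lia)) k
  · refine (isRoot_simple (by lia) (by lia)).principal_annihilatesVacuum hB hs hnd hnorm
      (isRoot_simple (by lia) (by lia)) ?_ ?_ k
    · rw [TwistedType.pair_simple _ ⟨l - 1, by lia⟩ ⟨l, by lia⟩ (by simp only; lia) rfl]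
      exact h1 _ _ (by simp only; lia) (by simp only; lia)
    · rw [← Complex.ofReal_mul, Real.mul_self_sqrt (by norm_num)]
      norm_num

theorem annihilatesVacuum_Aodd {l : ℕ} {hl : 2 ≤ l} (T : TwistedDatum (.Aodd l hl) 𝔱) (i k : ℕ) :
    ∃ t ∈ ({1, 2, 3} : Set ℕ), AnnihilatesVacuum B hB hs k t (T.F i) := by
  simp only [TwistedDatum.F, TwistedType.F]
  have hr : (TwistedType.Aodd l hl).rank = 2 * l - 1 := rfl
  have h1 (p q : Fin (TwistedType.Aodd l hl).rank) (_ : (q : ℕ) < 2 * l - 1)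
      (h : (p : ℕ) + 1 = q) : (TwistedType.Aodd l hl).cartan p q = -1 := by
    rw [TwistedType.cartan_Aodd, if_neg (by lia), if_pos (by lia)]
  have h0 (p q : Fin (TwistedType.Aodd l hl).rank) (_ : (q : ℕ) < 2 * l - 1)
      (h : (p : ℕ) + 2 ≤ q) : (TwistedType.Aodd l hl).cartan p q = 0 := by
    rw [TwistedType.cartan_Aodd, if_neg (by lia), if_neg (by lia)]
  split_ifs with hi0 hil
  · have hθ (p : Fin (TwistedType.Aodd l hl).rank) : (TwistedType.Aodd l hl).thetaZero p =
        if (p : ℕ) + 2 = 2 * l then 0 else 1 := by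
      change (1 : ℤ) - (if (p : ℕ) + 1 = 2 * l - 1 then 1 else 0) = _
      split_ifs <;> first | rfl | lia
    have hμ (p : Fin (TwistedType.Aodd l hl).rank) :
        TwistedType.muBar (TwistedType.Aodd l hl).thetaZero p = if (p : ℕ) = 0 then 0 else 1 := by
      have hp := p.2
      have hrev : ((Fin.rev p : Fin (TwistedType.Aodd l hl).rank) : ℕ) = 2 * l - 1 - (p + 1) :=
        Fin.val_rev p
      change (TwistedType.Aodd l hl).thetaZero (Fin.rev p) = _
      rw [hθ, hrev]
      split_ifs <;> first | rfl | lia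
    have hroot : T.IsRoot (TwistedType.Aodd l hl).thetaZero := by
      convert isRoot_partialSum (T := T) hr.ge h1 h0 (j := 2 * l - 3) (by lia) using 1
      funext p
      have hp := p.2
      rw [hθ, TwistedType.partialSum]
      split_ifs <;> first | rfl | lia
    have hroot' : T.IsRoot (TwistedType.muBar (TwistedType.Aodd l hl).thetaZero) := by
      -- The image of `θ⁰` is `θ - α₁`, the reflection of `θ` in `α₁`: the Cartan integer is `2 - 1
      -- = 1`.
      have hall := isRoot_partialSum (T := T) hr.ge h1 h0 (j := 2 * l - 2) (by lia)
      refine hall.step ⟨0, by lia⟩ (m := -1) ?_ ?_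
      · trans ∑ p : Fin (TwistedType.Aodd l hl).rank,
          ((if p = ⟨0, by lia⟩ then 2 else 0) + (if p = ⟨1, by lia⟩ then -1 else 0))
        · refine Finset.sum_congr rfl fun p _ => ?_
          have hp := p.2
          rw [TwistedType.cartan_Aodd, TwistedType.partialSum]
          simp only [Fin.ext_iff]
          split_ifs <;> first | rfl | lia
        · simp [Finset.sum_add_distrib]
      · intro p
        have hp := p.2
        rw [hμ, TwistedType.partialSum]
        simp only [Fin.ext_iff]
        split_ifs <;> first | rfl | lia
    refine ⟨2, by simp, hroot.sub_annihilatesVacuum_of_sub_eq hB hs hnd hnorm hroot'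
      (i := 1) (j := 2 * l - 1) ⟨0, by lia⟩ ⟨2 * l - 2, by lia⟩ rfl (by simp only; lia)
      (h0 _ _ (by simp only; lia) (by simp only; lia)) ?_ k⟩
    funext p
    have hp := p.2
    rw [Pi.sub_apply, Pi.sub_apply, hθ, hμ, TwistedType.simple, TwistedType.simple]
    split_ifs <;> first | rfl | lia
  · exact ⟨2, by simp, annihilatesVacuum_simple_add_simple hB hs hnd hnorm ⟨i - 1, by lia⟩
      ⟨2 * l - i - 1, by lia⟩ (by simp only; lia) (by simp only; lia) (h0 _ _ (by simp only; lia)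
      (by simp only; lia)) k⟩
  · exact ⟨1, by simp, annihilatesVacuum_simple hB hs hnd hnorm ⟨l - 1, by lia⟩
      (by simp only; lia) k⟩

theorem annihilatesVacuum_D {l : ℕ} {hl : 2 ≤ l} (T : TwistedDatum (.D l hl) 𝔱) (i k : ℕ) :
    ∃ t ∈ ({1, 2, 3} : Set ℕ), AnnihilatesVacuum B hB hs k t (T.F i) := by
  simp only [TwistedDatum.F, TwistedType.F]
  have hr : (TwistedType.D l hl).rank = l + 1 := rfl
  have h1 (p q : Fin (TwistedType.D l hl).rank) (_ : (q : ℕ) < l)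
      (h : (p : ℕ) + 1 = q) : (TwistedType.D l hl).cartan p q = -1 := by
    rw [TwistedType.cartan_D, if_neg (by lia), if_pos (by lia)]
  have h0 (p q : Fin (TwistedType.D l hl).rank) (_ : (q : ℕ) < l)
      (h : (p : ℕ) + 2 ≤ q) : (TwistedType.D l hl).cartan p q = 0 := by
    rw [TwistedType.cartan_D, if_neg (by lia), if_neg (by lia)]
  have hend : (TwistedType.D l hl).cartan ⟨l - 1, by lia⟩ ⟨l, by lia⟩ = 0 := by
    rw [TwistedType.cartan_D, if_neg (by simp only; lia), if_neg (by simp only; lia)]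
  split_ifs with hi0 hil
  · have hθ (p : Fin (TwistedType.D l hl).rank) : (TwistedType.D l hl).thetaZero p =
        if (p : ℕ) < l then 1 else 0 := rfl
    have hμ (p : Fin (TwistedType.D l hl).rank) :
        TwistedType.muBar (TwistedType.D l hl).thetaZero p = if (p : ℕ) + 1 = l then 0 else 1 := by
      have key (p : Fin (l + 1)) :
          (if (Equiv.swap (⟨l - 1, by lia⟩ : Fin (l + 1)) (Fin.last l) p : ℕ) < l then
            (1 : ℤ) else 0) = if (p : ℕ) + 1 = l then 0 else 1 := by
        have hp : (p : ℕ) < l + 1 := p.2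
        rw [Equiv.swap_apply_def]
        simp only [Fin.ext_iff, Fin.val_last]
        split_ifs <;> simp_all <;> lia
      exact key p
    have hroot : T.IsRoot (TwistedType.D l hl).thetaZero := by
      have := isRoot_partialSum (T := T) (N := l) (by lia) h1 h0 (j := l - 1) (by lia)
      rwa [Nat.sub_add_cancel (by lia)] at this
    have hroot' : T.IsRoot (TwistedType.muBar (TwistedType.D l hl).thetaZero) := by
      -- Reflecting `α₁ + ⋯ + α_{l-1}` in `α_{l+1}`, which is joined to `α_{l-1}` only, gives the
      -- image of `θ⁰`.
      have hall := isRoot_partialSum (T := T) (N := l) (by lia) h1 h0 (j := l - 2) (by lia)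
      refine hall.step ⟨l, by lia⟩ (m := 1) ?_ ?_
      · trans ∑ p : Fin (TwistedType.D l hl).rank, (if p = ⟨l - 2, by lia⟩ then -1 else 0)
        · refine Finset.sum_congr rfl fun p _ => ?_
          have hp := p.2
          rw [TwistedType.cartan_D, TwistedType.partialSum]
          simp only [Fin.ext_iff]
          split_ifs <;> first | rfl | lia
        · simp
      · intro p
        have hp := p.2
        rw [hμ, TwistedType.partialSum]
        simp only [Fin.ext_iff]
        split_ifs <;> first | rfl | lia
    refine ⟨2, by simp, hroot.sub_annihilatesVacuum_of_sub_eq hB hs hnd hnorm hroot'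
      (i := l) (j := l + 1) ⟨l - 1, by lia⟩ ⟨l, by lia⟩ (by simp only; lia) rfl hend ?_ k⟩
    funext p
    have hp := p.2
    rw [Pi.sub_apply, Pi.sub_apply, hθ, hμ, TwistedType.simple, TwistedType.simple]
    split_ifs <;> first | rfl | lia
  · exact ⟨1, by simp, annihilatesVacuum_simple hB hs hnd hnorm ⟨i - 1, by lia⟩
      (by simp only; lia) k⟩
  · exact ⟨2, by simp, annihilatesVacuum_simple_add_simple hB hs hnd hnorm ⟨l - 1, by lia⟩
      ⟨l, by lia⟩ (by simp only; lia) rfl hend k⟩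

theorem annihilatesVacuum_E6 (T : TwistedDatum .E6 𝔱) (i k : ℕ) :
    ∃ t ∈ ({1, 2, 3} : Set ℕ), AnnihilatesVacuum B hB hs k t (T.F i) := by
  -- A root fixed by `μ̄`; adding `α₂` or `α₄` gives `θ⁰` and its image.
  have base : T.IsRoot (![1, 1, 2, 1, 1, 1] : TwistedType.E6.Lattice) := by
    have h : T.IsRoot (![1, 0, 0, 0, 0, 0] : TwistedType.E6.Lattice) := by
      rw [show (![1, 0, 0, 0, 0, 0] : Fin 6 → ℤ) = Pi.single 0 1 by decide]
      exact isRoot_single _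
    replace h : T.IsRoot (![1, 1, 0, 0, 0, 0] : TwistedType.E6.Lattice) :=
      h.step (1 : Fin 6) (m := 1) (by decide)
        (fun p => by fin_cases p <;> rfl)
    replace h : T.IsRoot (![1, 1, 1, 0, 0, 0] : TwistedType.E6.Lattice) :=
      h.step (2 : Fin 6) (m := 1) (by decide)
        (fun p => by fin_cases p <;> rfl)
    replace h : T.IsRoot (![1, 1, 1, 1, 0, 0] : TwistedType.E6.Lattice) :=
      h.step (3 : Fin 6) (m := 1) (by decide)
        (fun p => by fin_cases p <;> rfl)
    replace h : T.IsRoot (![1, 1, 1, 1, 1, 0] : TwistedType.E6.Lattice) :=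
      h.step (4 : Fin 6) (m := 1) (by decide)
        (fun p => by fin_cases p <;> rfl)
    replace h : T.IsRoot (![1, 1, 1, 1, 1, 1] : TwistedType.E6.Lattice) :=
      h.step (5 : Fin 6) (m := 1) (by decide)
        (fun p => by fin_cases p <;> rfl)
    exact h.step (2 : Fin 6) (m := 1) (by decide)
        (fun p => by fin_cases p <;> rfl)
  have hroot : T.IsRoot TwistedType.E6.thetaZero :=
    base.step (1 : Fin 6) (m := 1) (by decide) (by decide)
  have hroot' : T.IsRoot (TwistedType.muBar TwistedType.E6.thetaZero) :=
    base.step (3 : Fin 6) (m := 1) (by decide) (by decide)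
  rcases i with - | - | - | - | i
  · exact ⟨2, by simp, hroot.sub_annihilatesVacuum hB hs hnd hnorm hroot' (by decide) k⟩
  · exact ⟨2, by simp, annihilatesVacuum_simple_add_simple (T := T) hB hs hnd hnorm
      (0 : Fin 6) (4 : Fin 6) rfl rfl (by decide) k⟩
  · exact ⟨2, by simp, annihilatesVacuum_simple_add_simple (T := T) hB hs hnd hnorm
      (1 : Fin 6) (3 : Fin 6) rfl rfl (by decide) k⟩
  · exact ⟨1, by simp, annihilatesVacuum_simple (T := T) hB hs hnd hnorm (2 : Fin 6) rfl k⟩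
  · exact ⟨1, by simp, annihilatesVacuum_simple (T := T) hB hs hnd hnorm (5 : Fin 6) rfl k⟩

theorem annihilatesVacuum_D4 (T : TwistedDatum .D4 𝔱) (i k : ℕ) :
    ∃ t ∈ ({1, 2, 3} : Set ℕ), AnnihilatesVacuum B hB hs k t (T.F i) := by
  have h1 : T.IsRoot (![1, 1, 0, 0] : TwistedType.D4.Lattice) := by
    have h : T.IsRoot (![1, 0, 0, 0] : TwistedType.D4.Lattice) := by
      rw [show (![1, 0, 0, 0] : Fin 4 → ℤ) = Pi.single 0 1 by decide]
      exact isRoot_single _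
    exact h.step (1 : Fin 4) (m := 1) (by decide)
        (fun p => by fin_cases p <;> rfl)
  have h2 : T.IsRoot (![0, 1, 0, 1] : TwistedType.D4.Lattice) := by
    have h : T.IsRoot (![0, 1, 0, 0] : TwistedType.D4.Lattice) := by
      rw [show (![0, 1, 0, 0] : Fin 4 → ℤ) = Pi.single 1 1 by decide]
      exact isRoot_single _
    exact h.step (3 : Fin 4) (m := 1) (by decide)
        (fun p => by fin_cases p <;> rfl)
  have hroot : T.IsRoot TwistedType.D4.thetaZero :=
    h1.step (2 : Fin 4) (m := 1) (by decide) (by decide)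
  have hroot' : T.IsRoot (TwistedType.muBar TwistedType.D4.thetaZero) :=
    h1.step (3 : Fin 4) (m := 1) (by decide) (by decide)
  have hroot'' : T.IsRoot (TwistedType.muBar (TwistedType.muBar TwistedType.D4.thetaZero)) :=
    h2.step (2 : Fin 4) (m := 1) (by decide) (by decide)
  -- The coefficients are arbitrary, so the same statement serves `F_0` with its cube roots of unity
  -- and `F_1`.
  have three {γ₁ γ₂ γ₃ : TwistedType.D4.Lattice} (r₁ : T.IsRoot γ₁) (r₂ : T.IsRoot γ₂)
      (r₃ : T.IsRoot γ₃) (h₁₂ : TwistedType.D4.pair γ₁ γ₂ = 0)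
      (h₁₃ : TwistedType.D4.pair γ₁ γ₃ = 0) (h₂₃ : TwistedType.D4.pair γ₂ γ₃ = 0) (s t : ℂ) :
      AnnihilatesVacuum B hB hs k 3
        (T.rootVec γ₁ + s • T.rootVec γ₂ + t • T.rootVec γ₃) := by
    have e₁₂ := r₁.lie_eq_zero hB hs hnd hnorm r₂ h₁₂.ge
    have e₁₃ := r₁.lie_eq_zero hB hs hnd hnorm r₃ h₁₃.ge
    have e₂₃ := r₂.lie_eq_zero hB hs hnd hnorm r₃ h₂₃.ge
    exact ((r₁.annihilatesVacuum hB hs hnd hnorm k).add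
      ((r₂.annihilatesVacuum hB hs hnd hnorm k).smul s) (by simp [e₁₂])).add
      ((r₃.annihilatesVacuum hB hs hnd hnorm k).smul t) (by simp [e₁₃, e₂₃])
  rcases i with - | - | i
  · exact ⟨3, by simp, three hroot hroot' hroot'' (by decide) (by decide) (by decide) _ _⟩
  · have hsimple (p : Fin 4) : T.IsRoot (-TwistedType.D4.simple (p + 1)) :=
      (isRoot_simple (by lia) p.2).neg
    have := three (hsimple 0) (hsimple 2) (hsimple 3) (by decide) (by decide) (by decide) 1 1
    rw [one_smul, one_smul] at this
    exact ⟨3, by simp, this⟩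
  · exact ⟨1, by simp, annihilatesVacuum_simple (T := T) hB hs hnd hnorm (1 : Fin 4) rfl k⟩

end TwistedDatum

end TwistedAffine

end

theorem proposition2p11 {𝔤 : Type*} [LieRing 𝔤] [LieAlgebra ℂ 𝔤] [FiniteDimensional ℂ 𝔤]
    [LieAlgebra.IsSimple ℂ 𝔤] (𝔱 : LieSubalgebra ℂ 𝔤) [𝔱.IsCartanSubalgebra]
    (X : TwistedAffine.TwistedType) (T : TwistedAffine.TwistedDatum X 𝔱)
    (B : LinearMap.BilinForm ℂ 𝔤) (hB : B.lieInvariant 𝔤) (hs : B.IsSymm) (hnd : B.Nondegenerate)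
    (hnorm : TwistedAffine.IsNormalized B 𝔱) (k : ℕ) (hk : 0 < k) :
    (∃ n₀ : ℕ, ∀ n ≥ n₀, ∀ i ≤ X.l,
      TwistedAffine.powVacuum B hB hs k (T.F i) n ∈
        TwistedAffine.maximalSubmodule B hB hs k) ∧
    ∀ i ≤ X.l, ∃ t ∈ X.multipliers i,
      TwistedAffine.powVacuum B hB hs k (T.F i) (t * k + 1) ∈
        TwistedAffine.maximalSubmodule B hB hs k := by
  have key (i : ℕ) : ∃ t ∈ X.multipliers i, t ≤ 4 ∧
      TwistedAffine.AnnihilatesVacuum B hB hs k t (T.F i) := by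
    have le4 {P : ℕ → Prop} (h : ∃ t ∈ ({1, 2, 3} : Set ℕ), P t) :
        ∃ t ∈ ({1, 2, 3} : Set ℕ), t ≤ 4 ∧ P t := by
      obtain ⟨t, ht, hP⟩ := h
      refine ⟨t, ht, ?_, hP⟩
      rcases ht with rfl | rfl | rfl <;> decide
    cases X with
    | Aeven l hl =>
      refine ⟨_, ?_, ?_, T.annihilatesVacuum_Aeven hB hs hnd hnorm i k⟩
      · simp only [TwistedAffine.TwistedType.multipliers]
        split_ifs <;> rfl
      · split_ifs <;> decide
    | Aodd l hl => exact le4 (T.annihilatesVacuum_Aodd hB hs hnd hnorm i k)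
    | D l hl => exact le4 (T.annihilatesVacuum_D hB hs hnd hnorm i k)
    | E6 => exact le4 (T.annihilatesVacuum_E6 hB hs hnd hnorm i k)
    | D4 => exact le4 (T.annihilatesVacuum_D4 hB hs hnd hnorm i k)
  -- The largest multiplier that occurs is `4`, so `n₀ = 4k + 1` serves all `i` at once.
  refine ⟨⟨4 * k + 1, fun n hn i _ => ?_⟩, fun i _ => ?_⟩
  · obtain ⟨t, -, ht, h⟩ := key i
    exact h n (le_trans (by gcongr) hn)
  · obtain ⟨t, ht, -, h⟩ := key i
    exact ⟨t, ht, h _ le_rfl⟩
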